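/- Let $\Omega$ be a locally compact Hausdorff space, and let $\mathcal M^+(\Omega)$ be the class of nonnegative, locally finite Radon measures on $\Omega$ (Borel measures that are inner regular with respect to compact sets). Let $\sigma\in\mathcal M^+(\Omega)$, and let $G\colon\Omega\times\Omega\to(0,+\infty]$ be a positive, lower semicontinuous kernel. For $\nu\in\mathcal M^+(\Omega)$ write $\mathbf G\nu(x)=\int_\Omega G(x,y)\,d\nu(y)$, and write $\mathbf G(f\,d\sigma)(x)=\int_\Omega G(x,y)f(y)\,d\sigma(y)$. Suppose that - $G$ is quasi-symmetric: there is a constant $a>0$ such that $a^{-1}G(y,x)\le G(x,y)\le a\,G(y,x)$ for all $x,y\in\Omega$; - $G$ satisfies the weak maximum principle: there is a constant $h\ge 1$ such that, for every $\nu\in\mathcal M^+(\Omega)$ and every $M>0$, if $\mathbf G\nu\le M$ on $\operatorname{supp}(\nu)$, then $\mathbf G\nu\le hM$ on $\Omega$. For $p>1$ and $0<r<p$, the $(p,r)$-weighted norm inequality is said to hold if there is a constant $C>0$ such that, for all $f\in L^p(\Omega,\sigma)$, the integral $\mathbf G(f\,d\sigma)(x)$ converges absolutely for $\sigma$-a.e.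 $x$ and $$\|\mathbf G(f\,d\sigma)\|_{L^r(\Omega,\sigma)}\le C\,\|f\|_{L^p(\Omega,\sigma)}.$$ (i) If $1<p<\infty$ and $0<r<p$, then the $(p,r)$-weighted norm inequality holds if and only if $$\int_\Omega(\mathbf G\sigma)^{\frac{pr}{p-r}}\,d\sigma<\infty.$$ (ii) If $0<q<1$ and $q<r<\infty$, then the following four statements are equivalent: - there exists a positive solution in $L^r(\Omega,\sigma)$, i.e. a function $u\in L^r(\Omega,\sigma)$ with $0<u<\infty$ and $u=\mathbf G(u^q\,d\sigma)$ $\sigma$-a.e.; - there exists a positive supersolution in $L^r(\Omega,\sigma)$, i.e. a function $u\in L^r(\Omega,\sigma)$ with $0<u<\infty$ and $u\ge\mathbf G(u^q\,d\sigma)$ $\sigma$-a.e.; - the $(p,r)$-weighted norm inequality holds with $p=r/q$; - $\displaystyle\int_\Omega(\mathbf G\sigma)^{\frac{r}{1-q}}\,d\sigma<\infty.$ -/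

import Mathlib

open MeasureTheory
open scoped ENNReal NNReal

namespace KernelPotential

/-- The class `M⁺(Ω)` of Radon measures: nonnegative locally finite Borel measures that are inner
regular with respect to compact sets on all Borel sets. -/
structure IsRadon {Ω : Type*} [TopologicalSpace Ω] [MeasurableSpace Ω] (ν : Measure Ω) :
    Prop where
  locallyFinite : IsLocallyFiniteMeasure ν
  innerRegular : ν.InnerRegular

/-- The potential `Gν(x) = ∫ G(x, y) dν(y) ∈ [0, +∞]`. -/
noncomputable def potential {Ω : Type*} [MeasurableSpace Ω] (G : Ω → Ω → ℝ≥0∞) (ν : Measure Ω)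
    (x : Ω) : ℝ≥0∞ :=
  ∫⁻ y, G x y ∂ν

/-- `G(g dσ)(x) = ∫ G(x, y) g(y) dσ(y) ∈ [0, +∞]` for a nonnegative density `g`. -/
noncomputable def potentialDensity {Ω : Type*} [MeasurableSpace Ω] (G : Ω → Ω → ℝ≥0∞)
    (σ : Measure Ω) (g : Ω → ℝ≥0∞) (x : Ω) : ℝ≥0∞ :=
  ∫⁻ y, G x y * g y ∂σ

/-- `G(f dσ)(x) = ∫ G(x, y) f(y) dσ(y)` for a real-valued `f`. It is the intended integral at those
`x` where the integral converges absolutely, that is, `∫ G(x, y) |f(y)| dσ(y) < ∞`; at such an `x`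
the kernel is finite for almost every `y` with `f y ≠ 0`, and `(+∞) * 0 = 0`. -/
noncomputable def kernelOperator {Ω : Type*} [MeasurableSpace Ω] (G : Ω → Ω → ℝ≥0∞)
    (σ : Measure Ω) (f : Ω → ℝ) (x : Ω) : ℝ :=
  ∫ y, (G x y).toReal * f y ∂σ

/-- Quasi-symmetry: `a⁻¹ G(y, x) ≤ G(x, y) ≤ a G(y, x)` for some constant `a > 0`. -/
def QuasiSymmetric {Ω : Type*} (G : Ω → Ω → ℝ≥0∞) : Prop :=
  ∃ a : ℝ≥0, 0 < a ∧ ∀ x y : Ω,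
    ((a⁻¹ : ℝ≥0) : ℝ≥0∞) * G y x ≤ G x y ∧ G x y ≤ (a : ℝ≥0∞) * G y x

/-- The weak maximum principle with some constant `h ≥ 1`: if the potential of a Radon measure is
bounded by `M` on the support of the measure, then it is bounded by `h M` everywhere. -/
def WeakMaximumPrinciple {Ω : Type*} [TopologicalSpace Ω] [MeasurableSpace Ω]
    (G : Ω → Ω → ℝ≥0∞) : Prop :=
  ∃ h : ℝ≥0, 1 ≤ h ∧ ∀ ν : Measure Ω, IsRadon ν → ∀ M : ℝ≥0, 0 < M →
    (∀ x ∈ ν.support, potential G ν x ≤ (M : ℝ≥0∞)) →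
      ∀ x : Ω, potential G ν x ≤ (h : ℝ≥0∞) * (M : ℝ≥0∞)

/-- The `(p, r)` weighted norm inequality `‖G(f dσ)‖_{L^r(σ)} ≤ C ‖f‖_{L^p(σ)}` for all
`f ∈ L^p(σ)`, with `C` independent of `f`; the integrals defining `G(f dσ)` converge absolutely
almost everywhere. -/
def WeightedNormInequality {Ω : Type*} [MeasurableSpace Ω] (G : Ω → Ω → ℝ≥0∞) (σ : Measure Ω)
    (p r : ℝ) : Prop :=
  ∃ C : ℝ≥0, 0 < C ∧ ∀ f : Ω → ℝ, MemLp f (ENNReal.ofReal p) σ →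
    (∀ᵐ x ∂σ, potentialDensity G σ (fun y => ‖f y‖ₑ) x < ∞) ∧
      eLpNorm (kernelOperator G σ f) (ENNReal.ofReal r) σ ≤
        (C : ℝ≥0∞) * eLpNorm f (ENNReal.ofReal p) σ

/-- `u` is a positive solution of `u = G(u^q σ)`: `0 < u < ∞` and the equation holds, both
`σ`-almost everywhere. -/
def IsPositiveSolution {Ω : Type*} [MeasurableSpace Ω] (G : Ω → Ω → ℝ≥0∞) (σ : Measure Ω)
    (q : ℝ) (u : Ω → ℝ) : Prop :=
  (∀ᵐ x ∂σ, 0 < u x) ∧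
    ∀ᵐ x ∂σ, ENNReal.ofReal (u x) = potentialDensity G σ (fun y => ENNReal.ofReal (u y) ^ q) x

/-- `u` is a positive supersolution: `0 < u < ∞` and `u ≥ G(u^q σ)`, both `σ`-almost
everywhere. -/
def IsPositiveSupersolution {Ω : Type*} [MeasurableSpace Ω] (G : Ω → Ω → ℝ≥0∞) (σ : Measure Ω)
    (q : ℝ) (u : Ω → ℝ) : Prop :=
  (∀ᵐ x ∂σ, 0 < u x) ∧
    ∀ᵐ x ∂σ, potentialDensity G σ (fun y => ENNReal.ofReal (u y) ^ q) x ≤ ENNReal.ofReal (u x)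

end KernelPotential

/-!
Write `w = Gσ`, `s = pr / (p - r)` and, for `q = r / p`, `S = 1 / (1 - q)`, so that `s = r S`. Every
admissible pair `(p, r)` is of the form `(r / q, r)`, and for `σ ≠ 0` everything follows from a
cycle of implications between the norm inequality, the existence of a supersolution in `L^r`, the
condition `∫ w ^ s dσ < ∞` and the existence of a solution.

The weak maximum principle enters through one observation: since `Gν` is lower semicontinuous, its
sublevel sets are closed, so the part of `ν` carried by `{Gν ≤ t}` has potential at most `h t`
everywhere (`potential_restrict_sublevel_le`). This has two consequences. For `α ≥ 1`, a power
`(Gν) ^ α` is at most a constant times `G((Gν) ^ (α - 1) ν)` (`rpow_potential_le`). For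
`0 < γ < 1`, `G((Gν) ^ (-γ) ν)` is at most a constant times `(Gν) ^ (1 - γ)`
(`exists_potentialDensity_rpow_neg_le`).

* The norm inequality gives a supersolution, because the iterates of `u ↦ g + G(u ^ q σ)` increase
  and stay bounded in `L^r` (`exists_supersolution_of_bound`).
* A supersolution `v` satisfies `v ≥ c w ^ S` (`rpow_potential_le_supersolution`): the best such
  constant on a suitable compact set satisfies a sublinear inequality that bounds it from below.
  Hence `∫ w ^ s dσ < ∞`. Moreover `c w ^ S` is a subsolution below `v`, and iteration between the
  two yields a solution (`exists_solution_of_supersolution`).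
* The integral condition gives the norm inequality by moving the operator to the other factor, at
  the price of the quasi-symmetry constant, and applying Hölder's inequality; for `r < 1` with a
  weight `w ^ (-γ)` (`exists_bound_of_lt_one`), for `r ≥ 1` through the power inequality for
  `G(fσ)` (`exists_bound_of_one_le`).

The space need not be second countable and `σ` need not be σ-finite, so neither the measurability of
`x ↦ ∫ G(x, y) dν(y)` nor the exchange of integrals comes from the product σ-algebra. Both are
obtained from the lower semicontinuity of `G` and the inner regularity of the measures
(`lowerSemicontinuous_potential`, `lintegral_potential_le_swap`).
-/

namespace KernelPotential

open Filter Topology Set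

/-! ### Inner regular measures and upper semicontinuous minorants -/

lemma exists_lt_lt_lt_add {a b c : ℝ≥0∞} (h : c < a + b) (ha : a ≠ 0) (hb : b ≠ 0) :
    ∃ a' < a, ∃ b' < b, c < a' + b' := by
  by_contra! H
  refine h.not_ge ?_
  have := ENNReal.biSup_add_biSup_le' (p := fun x => x < a) (q := fun x => x < b)
    (f := fun x => x) (g := fun x => x) ⟨0, pos_iff_ne_zero.2 ha⟩ ⟨0, pos_iff_ne_zero.2 hb⟩ H
  rwa [ENNReal.iSup_lt_eq_self, ENNReal.iSup_lt_eq_self] at this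

variable {Ω : Type*} [TopologicalSpace Ω] [MeasurableSpace Ω] {G : Ω → Ω → ℝ≥0∞}

theorem innerRegular_withDensity [T2Space Ω] [BorelSpace Ω] {μ : Measure Ω}
    (hμ : μ.InnerRegular) {f : Ω → ℝ≥0∞} (hf : Measurable f) :
    (μ.withDensity f).InnerRegular := by
  refine ⟨fun E hE r hr => ?_⟩
  rw [withDensity_apply _ hE] at hr
  suffices H : ∀ r < ∫⁻ x in E, f x ∂μ, ∃ K ⊆ E, IsCompact K ∧ r < ∫⁻ x in K, f x ∂μ by
    obtain ⟨K, hKE, hK, h⟩ := H r hr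
    exact ⟨K, hKE, hK, by rwa [withDensity_apply _ hK.measurableSet]⟩
  clear r hr
  refine Measurable.ennreal_induction (motive := fun f => ∀ r < ∫⁻ x in E, f x ∂μ,
    ∃ K ⊆ E, IsCompact K ∧ r < ∫⁻ x in K, f x ∂μ)
    ?_ ?_ ?_ hf
  · intro a A hA r hr
    rw [lintegral_indicator hA, lintegral_const, Measure.restrict_restrict hA,
      Measure.restrict_apply_univ] at hr
    by_cases ha : a = 0
    · simp [ha] at hr
    have hr' : r / a < μ (A ∩ E) := ENNReal.div_lt_of_lt_mul' hr
    obtain ⟨K, hKE, hK, h⟩ := hμ.innerRegular (hA.inter hE) _ hr'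
    refine ⟨K, fun x hx => (hKE hx).2, hK, ?_⟩
    rw [lintegral_indicator hA, lintegral_const, Measure.restrict_restrict hA,
      Measure.restrict_apply_univ, inter_eq_self_of_subset_right (fun x hx => (hKE hx).1)]
    have hr0 : r ≠ ⊤ := hr.ne_top
    rcases eq_or_ne a ⊤ with rfl | ha'
    · rw [ENNReal.top_mul (pos_of_gt h).ne']
      exact hr0.lt_top
    · rw [mul_comm]
      exact (ENNReal.div_lt_iff (Or.inl ha) (Or.inl ha')).1 h
  · intro f g _ hf hg ihf ihg r hr
    simp only [Pi.add_apply] at hr ⊢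
    rw [lintegral_add_left hf] at hr
    rcases eq_or_ne (∫⁻ x in E, f x ∂μ) 0 with h0 | hf0
    · rw [h0, zero_add] at hr
      obtain ⟨K, hKE, hK, h⟩ := ihg r hr
      exact ⟨K, hKE, hK, h.trans_le (lintegral_mono fun x => le_add_self)⟩
    rcases eq_or_ne (∫⁻ x in E, g x ∂μ) 0 with h0 | hg0
    · rw [h0, add_zero] at hr
      obtain ⟨K, hKE, hK, h⟩ := ihf r hr
      exact ⟨K, hKE, hK, h.trans_le (lintegral_mono fun x => le_self_add)⟩
    obtain ⟨a, ha, b, hb, hab⟩ := exists_lt_lt_lt_add hr hf0 hg0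
    obtain ⟨K, hKE, hK, h⟩ := ihf a ha
    obtain ⟨L, hLE, hL, h'⟩ := ihg b hb
    refine ⟨K ∪ L, union_subset hKE hLE, hK.union hL, ?_⟩
    rw [lintegral_add_left hf]
    exact hab.trans_le (add_le_add (h.le.trans (lintegral_mono_set subset_union_left))
      (h'.le.trans (lintegral_mono_set subset_union_right)))
  · intro f hf hmono ih r hr
    rw [lintegral_iSup hf hmono] at hr
    obtain ⟨n, hn⟩ := lt_iSup_iff.1 hr
    obtain ⟨K, hKE, hK, h⟩ := ih n r hn
    exact ⟨K, hKE, hK, h.trans_le (lintegral_mono fun x => le_iSup (fun n => f n x) n)⟩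

/-- The integral against an inner regular measure is approximated from below by integrals of finite
upper semicontinuous functions with compact support. -/
theorem exists_upperSemicontinuous_le [T2Space Ω] [BorelSpace Ω] {μ : Measure Ω}
    (hμ : μ.InnerRegular) {f : Ω → ℝ≥0∞} (hf : Measurable f) :
    ∀ c < ∫⁻ x, f x ∂μ, ∃ (φ : Ω → ℝ≥0∞) (K : Set Ω), UpperSemicontinuous φ ∧ IsCompact K ∧
      (∀ x ∉ K, φ x = 0) ∧ (∀ x, φ x ≤ f x) ∧ (∀ x, φ x < ∞) ∧ c < ∫⁻ x, φ x ∂μ := by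
  refine Measurable.ennreal_induction (motive := fun f => ∀ c < ∫⁻ x, f x ∂μ,
      ∃ (φ : Ω → ℝ≥0∞) (K : Set Ω),
      UpperSemicontinuous φ ∧ IsCompact K ∧ (∀ x ∉ K, φ x = 0) ∧ (∀ x, φ x ≤ f x) ∧
      (∀ x, φ x < ∞) ∧ c < ∫⁻ x, φ x ∂μ)
    ?_ ?_ ?_ hf
  · intro a A hA c hc
    rw [lintegral_indicator_const hA] at hc
    have hA0 : μ A ≠ 0 := by rintro h; simp [h] at hc
    -- a finite constant below `a` that is still large enough
    obtain ⟨b, hba, hb, hcb⟩ : ∃ b ≤ a, b < ∞ ∧ c < b * μ A := by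
      rcases eq_or_ne a ⊤ with rfl | ha
      · rcases eq_or_ne (μ A) ⊤ with hA' | hA'
        · exact ⟨1, le_top, ENNReal.one_lt_top, by simpa [hA'] using hc.ne_top.lt_top⟩
        · have : c / μ A < ⊤ := ENNReal.div_lt_top hc.ne_top hA0
          obtain ⟨b, hb, hb'⟩ := exists_between this
          exact ⟨b, le_top, hb', (ENNReal.div_lt_iff (Or.inl hA0) (Or.inl hA')).1 hb⟩
      · exact ⟨a, le_rfl, ha.lt_top, hc⟩
    have hb0 : b ≠ 0 := by rintro rfl; simp at hcb
    obtain ⟨K, hKA, hK, h⟩ := hμ.innerRegular hA _ (ENNReal.div_lt_of_lt_mul' hcb)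
    refine ⟨K.indicator fun _ => b, K, hK.isClosed.upperSemicontinuous_indicator zero_le, hK,
      fun x hx => indicator_of_notMem hx _, fun x => ?_, fun x => ?_, ?_⟩
    · by_cases hx : x ∈ K
      · simp [hx, hKA hx, hba]
      · simp [hx]
    · by_cases hx : x ∈ K <;> simp [hx, hb]
    · rw [lintegral_indicator_const hK.measurableSet, mul_comm]
      exact (ENNReal.div_lt_iff (Or.inl hb0) (Or.inl hb.ne)).1 h
  · intro f g _ hf hg ihf ihg r hr
    simp only [Pi.add_apply] at hr ⊢
    rw [lintegral_add_left hf] at hr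
    rcases eq_or_ne (∫⁻ x, f x ∂μ) 0 with h0 | hf0
    · rw [h0, zero_add] at hr
      obtain ⟨φ, K, h1, h2, h3, h4, h5, h6⟩ := ihg r hr
      exact ⟨φ, K, h1, h2, h3, fun x => (h4 x).trans le_add_self, h5, h6⟩
    rcases eq_or_ne (∫⁻ x, g x ∂μ) 0 with h0 | hg0
    · rw [h0, add_zero] at hr
      obtain ⟨φ, K, h1, h2, h3, h4, h5, h6⟩ := ihf r hr
      exact ⟨φ, K, h1, h2, h3, fun x => (h4 x).trans le_self_add, h5, h6⟩
    obtain ⟨a, ha, b, hb, hab⟩ := exists_lt_lt_lt_add hr hf0 hg0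
    obtain ⟨φ, K, h1, h2, h3, h4, h5, h6⟩ := ihf a ha
    obtain ⟨ψ, L, k1, k2, k3, k4, k5, k6⟩ := ihg b hb
    refine ⟨fun x => φ x + ψ x, K ∪ L, h1.add k1, h2.union k2, fun x hx => ?_,
      fun x => add_le_add (h4 x) (k4 x), fun x => ENNReal.add_lt_top.2 ⟨h5 x, k5 x⟩, ?_⟩
    · rw [mem_union, not_or] at hx
      simp [h3 x hx.1, k3 x hx.2]
    · rw [lintegral_add_left h1.measurable]
      exact hab.trans_le (add_le_add h6.le k6.le)
  · intro f hf hmono ih r hr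
    rw [lintegral_iSup hf hmono] at hr
    obtain ⟨n, hn⟩ := lt_iSup_iff.1 hr
    obtain ⟨φ, K, h1, h2, h3, h4, h5, h6⟩ := ih n r hn
    exact ⟨φ, K, h1, h2, h3, fun x => (h4 x).trans (le_iSup (fun n => f n x) n), h5, h6⟩

/-- For a positive integrand the minorant can be taken strictly smaller at every point; it is this
strictness that makes the tube lemma applicable. -/
theorem exists_upperSemicontinuous_lt [T2Space Ω] [BorelSpace Ω] {μ : Measure Ω}
    (hμ : μ.InnerRegular) {f : Ω → ℝ≥0∞} (hf : Measurable f) (hpos : ∀ x, 0 < f x)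
    {c : ℝ≥0∞} (hc : c < ∫⁻ x, f x ∂μ) :
    ∃ (φ : Ω → ℝ≥0∞) (K : Set Ω), UpperSemicontinuous φ ∧ IsCompact K ∧
      (∀ x ∉ K, φ x = 0) ∧ (∀ x, φ x < f x) ∧ c < ∫⁻ x, φ x ∂μ := by
  obtain ⟨φ, K, h1, h2, h3, h4, h5, h6⟩ := exists_upperSemicontinuous_le hμ hf c hc
  have hI : ∫⁻ x, φ x ∂μ ≠ 0 := (pos_of_gt h6).ne'
  have : c / ∫⁻ x, φ x ∂μ < 1 := by
    rw [ENNReal.div_lt_iff (Or.inl hI) (Or.inr h6.ne_top), one_mul]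
    exact h6
  obtain ⟨θ, hθ, hθ1⟩ := exists_between this
  refine ⟨fun x => θ * φ x, K, ?_, h2, fun x hx => by simp [h3 x hx], fun x => ?_, ?_⟩
  · exact (ENNReal.continuous_const_mul hθ1.ne_top).comp_upperSemicontinuous h1
      (fun a b hab => mul_le_mul_right hab θ)
  · rcases eq_or_ne (φ x) 0 with h0 | h0
    · simpa [h0] using hpos x
    · calc θ * φ x < 1 * φ x := (ENNReal.mul_lt_mul_iff_left h0 (h5 x).ne).2 hθ1
        _ = φ x := one_mul _
        _ ≤ f x := h4 x
  · rw [lintegral_const_mul _ h1.measurable]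
    exact (ENNReal.div_lt_iff (Or.inl hI) (Or.inr h6.ne_top)).1 hθ

/-! ### Lower semicontinuity of potentials and the exchange of integrals -/

lemma measurable_kernel [BorelSpace Ω]
    (hlsc : LowerSemicontinuous (fun z : Ω × Ω => G z.1 z.2)) (x : Ω) : Measurable (G x) :=
  (hlsc.comp (g := fun y => (x, y)) (by fun_prop)).measurable

/-- A value below `Gν(x₀)` is the integral of one function `φ` that lies below `G(x, ·)` for all
`x` near `x₀` at once. -/
theorem exists_eventually_minorant [T2Space Ω] [BorelSpace Ω] (hpos : ∀ x y, 0 < G x y)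
    (hlsc : LowerSemicontinuous (fun z : Ω × Ω => G z.1 z.2)) {ν : Measure Ω}
    (hν : ν.InnerRegular) {x₀ : Ω} {c : ℝ≥0∞} (hc : c < potential G ν x₀) :
    ∃ φ : Ω → ℝ≥0∞, Measurable φ ∧ c < ∫⁻ y, φ y ∂ν ∧ ∀ᶠ x in 𝓝 x₀, ∀ y, φ y ≤ G x y := by
  obtain ⟨φ, K, h1, h2, h3, h4, h6⟩ := exists_upperSemicontinuous_lt hν
    (measurable_kernel hlsc x₀) (hpos x₀) hc
  refine ⟨φ, h1.measurable, h6, ?_⟩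
  have hopen : IsOpen {z : Ω × Ω | φ z.2 < G z.1 z.2} := by
    rw [isOpen_iff_mem_nhds]
    rintro ⟨x, y⟩ hxy
    obtain ⟨b, hb1, hb2⟩ := exists_between (show φ y < G x y from hxy)
    have e1 : ∀ᶠ z : Ω × Ω in 𝓝 (x, y), φ z.2 < b :=
      ((continuous_snd (X := Ω) (Y := Ω)).tendsto (x, y)).eventually (h1 y b hb1)
    filter_upwards [e1, hlsc (x, y) b hb2] with z hz1 hz2 using hz1.trans hz2
  obtain ⟨U, V, hU, -, hxU, hKV, hUV⟩ := generalized_tube_lemma (isCompact_singleton (x := x₀))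
    h2 hopen (by rintro ⟨x, y⟩ ⟨rfl, -⟩; exact h4 y)
  filter_upwards [hU.mem_nhds (hxU rfl)] with x hx y
  by_cases hy : y ∈ K
  · exact (hUV (mk_mem_prod hx (hKV hy))).le
  · simp [h3 y hy]

theorem lowerSemicontinuous_potential [T2Space Ω] [BorelSpace Ω] (hpos : ∀ x y, 0 < G x y)
    (hlsc : LowerSemicontinuous (fun z : Ω × Ω => G z.1 z.2)) {ν : Measure Ω}
    (hν : ν.InnerRegular) : LowerSemicontinuous (potential G ν) := by
  intro x₀ c hc
  obtain ⟨φ, -, hφ, h⟩ := exists_eventually_minorant hpos hlsc hν hc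
  filter_upwards [h] with x hx using hφ.trans_le (lintegral_mono hx)

lemma potential_pos [BorelSpace Ω] (hpos : ∀ x y, 0 < G x y)
    (hlsc : LowerSemicontinuous (fun z : Ω × Ω => G z.1 z.2)) {ν : Measure Ω} (hν : ν ≠ 0)
    (x : Ω) : 0 < potential G ν x := by
  rw [potential, lintegral_pos_iff_support (measurable_kernel hlsc x)]
  have : Function.support (G x) = univ := by
    ext y; simp [(hpos x y).ne']
  rw [this]
  exact Measure.measure_univ_pos.2 hν

/-- One half of Tonelli's theorem for the kernel. The kernel need not be measurable for the product
of the Borel σ-algebras and the measures need not be σ-finite, so the exchange rests on lower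
semicontinuity and inner regularity: near each point `G` is compared with a function of `y`
alone, and compactness patches these comparisons together. -/
theorem lintegral_potential_le_swap [T2Space Ω] [BorelSpace Ω] (hpos : ∀ x y, 0 < G x y)
    (hlsc : LowerSemicontinuous (fun z : Ω × Ω => G z.1 z.2)) {μ ν : Measure Ω}
    (hμ : μ.InnerRegular) (hν : ν.InnerRegular) :
    ∫⁻ x, potential G ν x ∂μ ≤ ∫⁻ y, ∫⁻ x, G x y ∂μ ∂ν := by
  rcases eq_or_ne ν 0 with rfl | hν0
  · simp [potential]
  refine le_of_forall_lt fun c hc => ?_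
  obtain ⟨φ, K, h1, h2, h3, h4, h6⟩ := exists_upperSemicontinuous_lt hμ
    (lowerSemicontinuous_potential hpos hlsc hν).measurable (potential_pos hpos hlsc hν0) hc
  refine h6.trans_le ?_
  obtain ⟨V, hV, hKV, hint⟩ : ∃ V, IsOpen V ∧ K ⊆ V ∧ ∀ T ⊆ V, MeasurableSet T →
      ∫⁻ x in T, φ x ∂μ ≤ ∫⁻ y, ∫⁻ x in T, G x y ∂μ ∂ν := by
    refine h2.induction_on (p := fun S => ∃ V, IsOpen V ∧ S ⊆ V ∧ ∀ T ⊆ V, MeasurableSet T →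
      ∫⁻ x in T, φ x ∂μ ≤ ∫⁻ y, ∫⁻ x in T, G x y ∂μ ∂ν) ?_ ?_ ?_ ?_
    · refine ⟨∅, isOpen_empty, subset_rfl, fun T hT _ => ?_⟩
      simp [subset_empty_iff.1 hT]
    · rintro s t hst ⟨V, hV, htV, h⟩
      exact ⟨V, hV, hst.trans htV, h⟩
    · rintro s t ⟨V, hV, hsV, h⟩ ⟨W, hW, htW, h'⟩
      refine ⟨V ∪ W, hV.union hW, union_subset_union hsV htW, fun T hT hTm => ?_⟩
      calc ∫⁻ x in T, φ x ∂μ = ∫⁻ x in T ∩ V, φ x ∂μ + ∫⁻ x in T \ V, φ x ∂μ :=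
            (lintegral_inter_add_sdiff _ _ hV.measurableSet).symm
        _ ≤ ∫⁻ y, ∫⁻ x in T ∩ V, G x y ∂μ ∂ν + ∫⁻ y, ∫⁻ x in T \ V, G x y ∂μ ∂ν :=
            add_le_add (h _ inter_subset_right (hTm.inter hV.measurableSet))
              (h' _ (fun x hx => (hT hx.1).resolve_left hx.2) (hTm.diff hV.measurableSet))
        _ ≤ ∫⁻ y, (∫⁻ x in T ∩ V, G x y ∂μ + ∫⁻ x in T \ V, G x y ∂μ) ∂ν := le_lintegral_add _ _
        _ = ∫⁻ y, ∫⁻ x in T, G x y ∂μ ∂ν := by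
            simp_rw [lintegral_inter_add_sdiff _ _ hV.measurableSet]
    · intro x hx
      obtain ⟨b, hb1, hb2⟩ := exists_between (h4 x)
      obtain ⟨ψ, hψ, hbψ, hev⟩ := exists_eventually_minorant hpos hlsc hν hb2
      obtain ⟨V, hVsub, hV, hxV⟩ := eventually_nhds_iff.1 (hev.and (h1 x b hb1))
      refine ⟨V, mem_nhdsWithin_of_mem_nhds (hV.mem_nhds hxV), V, hV, subset_rfl,
        fun T hT hTm => ?_⟩
      calc ∫⁻ x in T, φ x ∂μ ≤ ∫⁻ x in T, b ∂μ :=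
            setLIntegral_mono' hTm fun z hz => (hVsub z (hT hz)).2.le
        _ = b * μ T := by simp
        _ ≤ (∫⁻ y, ψ y ∂ν) * μ T := by gcongr
        _ = ∫⁻ y, ψ y * μ T ∂ν := (lintegral_mul_const _ hψ).symm
        _ = ∫⁻ y, ∫⁻ x in T, ψ y ∂μ ∂ν := by simp
        _ ≤ ∫⁻ y, ∫⁻ x in T, G x y ∂μ ∂ν :=
            lintegral_mono fun y => setLIntegral_mono' hTm fun z hz => (hVsub z (hT hz)).1 y
  calc ∫⁻ x, φ x ∂μ = ∫⁻ x in K, φ x ∂μ := by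
        rw [← lintegral_indicator h2.measurableSet]
        congr 1
        ext x
        by_cases hx : x ∈ K <;> simp [hx, h3]
    _ ≤ ∫⁻ y, ∫⁻ x in K, G x y ∂μ ∂ν := hint K hKV h2.measurableSet
    _ ≤ ∫⁻ y, ∫⁻ x, G x y ∂μ ∂ν := lintegral_mono fun y => setLIntegral_le_lintegral _ _

/-! ### Potentials with a density -/

lemma potentialDensity_mono {Ω : Type*} [MeasurableSpace Ω] {G : Ω → Ω → ℝ≥0∞}
    {σ : Measure Ω} {f g : Ω → ℝ≥0∞} (h : f ≤ᵐ[σ] g) (x : Ω) :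
    potentialDensity G σ f x ≤ potentialDensity G σ g x :=
  lintegral_mono_ae (h.mono fun _ hy => mul_le_mul_right hy _)

lemma potentialDensity_congr {Ω : Type*} [MeasurableSpace Ω] {G : Ω → Ω → ℝ≥0∞}
    {σ : Measure Ω} {f g : Ω → ℝ≥0∞} (h : f =ᵐ[σ] g) :
    potentialDensity G σ f = potentialDensity G σ g :=
  funext fun _ => lintegral_congr_ae (h.mono fun _ hy => by simp only [hy])

lemma potentialDensity_one {Ω : Type*} [MeasurableSpace Ω] {G : Ω → Ω → ℝ≥0∞} (σ : Measure Ω) :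
    potentialDensity G σ (fun _ => 1) = potential G σ := by
  ext x; simp [potentialDensity, potential]

lemma potentialDensity_indicator {Ω : Type*} [MeasurableSpace Ω] {G : Ω → Ω → ℝ≥0∞}
    {σ : Measure Ω} {E : Set Ω} (hE : MeasurableSet E)
    (g : Ω → ℝ≥0∞) (x : Ω) :
    potentialDensity G σ (E.indicator g) x = potentialDensity G (σ.restrict E) g x := by
  rw [potentialDensity, potentialDensity, ← lintegral_indicator hE]
  exact lintegral_congr fun y => by by_cases hy : y ∈ E <;> simp [hy]

lemma potentialDensity_eq_potential_withDensity [BorelSpace Ω]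
    (hlsc : LowerSemicontinuous (fun z : Ω × Ω => G z.1 z.2)) {σ : Measure Ω} {g : Ω → ℝ≥0∞}
    (hg : Measurable g) (x : Ω) : potentialDensity G σ g x = potential G (σ.withDensity g) x := by
  rw [potential, lintegral_withDensity_eq_lintegral_mul σ hg (measurable_kernel hlsc x)]
  exact lintegral_congr fun y => mul_comm _ _

lemma lowerSemicontinuous_potentialDensity [T2Space Ω] [BorelSpace Ω] (hpos : ∀ x y, 0 < G x y)
    (hlsc : LowerSemicontinuous (fun z : Ω × Ω => G z.1 z.2)) {σ : Measure Ω}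
    (hσ : σ.InnerRegular) {g : Ω → ℝ≥0∞} (hg : Measurable g) :
    LowerSemicontinuous (potentialDensity G σ g) := by
  rw [funext (potentialDensity_eq_potential_withDensity hlsc hg)]
  exact lowerSemicontinuous_potential hpos hlsc (innerRegular_withDensity hσ hg)

lemma potentialDensity_const_mul [BorelSpace Ω]
    (hlsc : LowerSemicontinuous (fun z : Ω × Ω => G z.1 z.2)) {σ : Measure Ω} {g : Ω → ℝ≥0∞}
    (hg : Measurable g) (c : ℝ≥0∞) (x : Ω) :
    potentialDensity G σ (fun y => c * g y) x = c * potentialDensity G σ g x := by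
  rw [potentialDensity, potentialDensity,
    ← lintegral_const_mul (f := fun y => G x y * g y) _ ((measurable_kernel hlsc x).mul hg)]
  exact lintegral_congr fun y => mul_left_comm _ _ _

lemma potentialDensity_iSup [BorelSpace Ω]
    (hlsc : LowerSemicontinuous (fun z : Ω × Ω => G z.1 z.2)) {σ : Measure Ω} {g : ℕ → Ω → ℝ≥0∞}
    (hg : ∀ n, Measurable (g n)) (hmono : Monotone g) (x : Ω) :
    potentialDensity G σ (fun y => ⨆ n, g n y) x = ⨆ n, potentialDensity G σ (g n) x := by
  simp only [potentialDensity, ENNReal.mul_iSup]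
  exact lintegral_iSup (fun n => (measurable_kernel hlsc x).mul (hg n))
    fun m n hmn y => mul_le_mul_right (hmono hmn y) _

/-- Quasi-symmetry lets the operator be moved from one factor to the other. -/
theorem lintegral_potentialDensity_mul_le [T2Space Ω] [BorelSpace Ω] (hpos : ∀ x y, 0 < G x y)
    (hlsc : LowerSemicontinuous (fun z : Ω × Ω => G z.1 z.2)) {a : ℝ≥0∞}
    (hsymm : ∀ x y, G x y ≤ a * G y x) {σ : Measure Ω} (hσ : σ.InnerRegular)
    {f g : Ω → ℝ≥0∞} (hf : Measurable f) (hg : Measurable g) :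
    ∫⁻ x, potentialDensity G σ f x * g x ∂σ ≤ a * ∫⁻ y, f y * potentialDensity G σ g y ∂σ := by
  have hmf := (lowerSemicontinuous_potentialDensity hpos hlsc hσ hf).measurable
  have hmg := (lowerSemicontinuous_potentialDensity hpos hlsc hσ hg).measurable
  calc ∫⁻ x, potentialDensity G σ f x * g x ∂σ
      = ∫⁻ x, potentialDensity G σ f x ∂(σ.withDensity g) := by
        rw [lintegral_withDensity_eq_lintegral_mul σ hg hmf]
        exact lintegral_congr fun y => mul_comm _ _
    _ = ∫⁻ x, potential G (σ.withDensity f) x ∂(σ.withDensity g) := by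
        simp_rw [potentialDensity_eq_potential_withDensity hlsc hf]
    _ ≤ ∫⁻ y, ∫⁻ x, G x y ∂(σ.withDensity g) ∂(σ.withDensity f) :=
        lintegral_potential_le_swap hpos hlsc (innerRegular_withDensity hσ hg)
          (innerRegular_withDensity hσ hf)
    _ ≤ ∫⁻ y, a * potentialDensity G σ g y ∂(σ.withDensity f) := by
        refine lintegral_mono fun y => ?_
        simp only [potentialDensity_eq_potential_withDensity hlsc hg]
        rw [potential, ← lintegral_const_mul _ (measurable_kernel hlsc y)]
        exact lintegral_mono fun x => hsymm x y
    _ = a * ∫⁻ y, f y * potentialDensity G σ g y ∂σ := by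
        rw [lintegral_const_mul _ hmg, lintegral_withDensity_eq_lintegral_mul σ hf hmg]
        rfl

lemma iSup_rpow {ι : Sort*} {q : ℝ} (hq : 0 < q) (f : ι → ℝ≥0∞) :
    (⨆ i, f i) ^ q = ⨆ i, f i ^ q :=
  (ENNReal.orderIsoRpow q hq).map_iSup f

/-! ### Consequences of the weak maximum principle -/

lemma IsRadon.restrict [T2Space Ω] [BorelSpace Ω] {ν : Measure Ω} (hν : IsRadon ν) {E : Set Ω}
    (hE : MeasurableSet E) : IsRadon (ν.restrict E) := by
  refine ⟨?_, ?_⟩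
  · have := hν.locallyFinite
    infer_instance
  · rw [← withDensity_indicator_one hE]
    exact innerRegular_withDensity hν.innerRegular (measurable_one.indicator hE)

/-- The weak maximum principle applied to the part of `ν` carried by a sublevel set of `Gν`, which
is closed because `Gν` is lower semicontinuous. -/
theorem potential_restrict_sublevel_le [T2Space Ω] [BorelSpace Ω] (hpos : ∀ x y, 0 < G x y)
    (hlsc : LowerSemicontinuous (fun z : Ω × Ω => G z.1 z.2)) {h : ℝ≥0}
    (hwmp : ∀ ν : Measure Ω, IsRadon ν → ∀ M : ℝ≥0, 0 < M →
      (∀ x ∈ ν.support, potential G ν x ≤ (M : ℝ≥0∞)) → ∀ x, potential G ν x ≤ h * M)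
    {ν : Measure Ω} (hν : IsRadon ν) {t : ℝ≥0∞} (ht0 : t ≠ 0) (ht : t ≠ ∞) (x : Ω) :
    potential G (ν.restrict {y | potential G ν y ≤ t}) x ≤ h * t := by
  have hcl : IsClosed {y | potential G ν y ≤ t} :=
    (lowerSemicontinuous_potential hpos hlsc hν.innerRegular).isClosed_preimage t
  lift t to ℝ≥0 using ht
  refine hwmp _ (hν.restrict hcl.measurableSet) t (pos_iff_ne_zero.2 (by simpa using ht0))
    (fun y hy => ?_) x
  have hy' := (Measure.support_restrict_subset hy).1
  rw [hcl.closure_eq] at hy'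
  exact (lintegral_mono' Measure.restrict_le_self le_rfl).trans hy'

/-- A power `s ≥ 1` of a potential is dominated by the potential of a power: at `x`, at least half
of `Gν(x)` comes from the set where `Gν` exceeds `Gν(x) / (2h)`. -/
theorem rpow_potential_le [T2Space Ω] [BorelSpace Ω] (hpos : ∀ x y, 0 < G x y)
    (hlsc : LowerSemicontinuous (fun z : Ω × Ω => G z.1 z.2)) {h : ℝ≥0} (hh : 1 ≤ h)
    (hwmp : ∀ ν : Measure Ω, IsRadon ν → ∀ M : ℝ≥0, 0 < M →
      (∀ x ∈ ν.support, potential G ν x ≤ (M : ℝ≥0∞)) → ∀ x, potential G ν x ≤ h * M)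
    {ν : Measure Ω} (hν : IsRadon ν) {s : ℝ} (hs : 1 ≤ s) (x : Ω) :
    potential G ν x ^ s ≤
      2 * (2 * h) ^ (s - 1) * potentialDensity G ν (fun y => potential G ν y ^ (s - 1)) x := by
  set w := potential G ν with hw
  have hwl : LowerSemicontinuous w := lowerSemicontinuous_potential hpos hlsc hν.innerRegular
  have hs1 : 0 ≤ s - 1 := by linarith
  have hsplit : ∀ t : ℝ≥0∞, t ≠ 0 → t ≠ ∞ →
      w x ≤ h * t + ∫⁻ y in {y | w y ≤ t}ᶜ, G x y ∂ν := by
    intro t ht0 ht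
    have hm : MeasurableSet {y | w y ≤ t} := (hwl.isClosed_preimage t).measurableSet
    calc w x = ∫⁻ y in {y | w y ≤ t}, G x y ∂ν + ∫⁻ y in {y | w y ≤ t}ᶜ, G x y ∂ν :=
          (lintegral_add_compl _ hm).symm
      _ ≤ _ := add_le_add_left (potential_restrict_sublevel_le hpos hlsc hwmp hν ht0 ht x) _
  have hlow : ∀ t : ℝ≥0∞, t ^ (s - 1) * ∫⁻ y in {y | w y ≤ t}ᶜ, G x y ∂ν ≤
      potentialDensity G ν (fun y => w y ^ (s - 1)) x := by
    intro t
    have hm : MeasurableSet {y | w y ≤ t} := (hwl.isClosed_preimage t).measurableSet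
    rw [← lintegral_const_mul _ (measurable_kernel hlsc x)]
    refine (setLIntegral_mono' hm.compl fun y hy => ?_).trans (setLIntegral_le_lintegral _ _)
    rw [mul_comm]
    exact mul_le_mul_right (ENNReal.rpow_le_rpow (not_le.1 (mem_compl_iff _ _ |>.1 hy)).le hs1) _
  have hh0 : (2 * h : ℝ≥0∞) ≠ 0 := by
    have : (h : ℝ≥0∞) ≠ 0 := by exact_mod_cast (zero_lt_one.trans_le hh).ne'
    simp [this]
  have hhT : (2 * h : ℝ≥0∞) ≠ ∞ := ENNReal.mul_ne_top (by simp) ENNReal.coe_ne_top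
  rcases eq_or_ne (w x) 0 with h0 | h0
  · rw [h0, ENNReal.zero_rpow_of_pos (by linarith)]
    exact zero_le
  rcases eq_or_ne (w x) ∞ with hT | hT
  · have h1 := hsplit 1 one_ne_zero ENNReal.one_ne_top
    rw [hT, mul_one, top_le_iff, ENNReal.add_eq_top] at h1
    have h2 := hlow 1
    rw [h1.resolve_left ENNReal.coe_ne_top, ENNReal.one_rpow, one_mul, top_le_iff] at h2
    rw [h2, ENNReal.mul_top]
    · exact le_top
    · exact mul_ne_zero two_ne_zero (by simp [ENNReal.rpow_eq_zero_iff, hh0, hhT])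
  · have ht0 : w x / (2 * h) ≠ 0 := ENNReal.div_ne_zero.2 ⟨h0, hhT⟩
    have ht : w x / (2 * h) ≠ ∞ := ENNReal.div_ne_top hT hh0
    have h1 := hsplit _ ht0 ht
    have hmul : 2 * h * (w x / (2 * h)) = w x := ENNReal.mul_div_cancel hh0 hhT
    have hfin : (h : ℝ≥0∞) * (w x / (2 * h)) ≠ ∞ := ENNReal.mul_ne_top ENNReal.coe_ne_top ht
    have h2 : (h : ℝ≥0∞) * (w x / (2 * h)) ≤ ∫⁻ y in {y | w y ≤ w x / (2 * h)}ᶜ, G x y ∂ν := by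
      rw [← ENNReal.add_le_add_iff_left hfin]
      refine le_trans (le_of_eq ?_) h1
      rw [← two_mul, ← mul_assoc, hmul]
    calc w x ^ s = w x * w x ^ (s - 1) := by
          conv_lhs => rw [show s = 1 + (s - 1) by ring,
            ENNReal.rpow_add_of_nonneg _ _ zero_le_one hs1, ENNReal.rpow_one]
      _ = (2 * h * (w x / (2 * h))) * (2 * h * (w x / (2 * h))) ^ (s - 1) := by rw [hmul]
      _ = 2 * (2 * h) ^ (s - 1) * ((w x / (2 * h)) ^ (s - 1) * (h * (w x / (2 * h)))) := by
          rw [ENNReal.mul_rpow_of_nonneg _ _ hs1]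
          ring
      _ ≤ _ := mul_le_mul_right ((mul_le_mul_right h2 _).trans (hlow _)) _

/-- Negative powers `-γ` with `0 < γ < 1`: the set where `Gν > Gν(x)` is harmless, and on the dyadic
layers of `{Gν ≤ Gν(x)}` the maximum principle yields a geometric series with ratio
`2 ^ (-(1 - γ))`. -/
theorem exists_potentialDensity_rpow_neg_le [T2Space Ω] [BorelSpace Ω] (hpos : ∀ x y, 0 < G x y)
    (hlsc : LowerSemicontinuous (fun z : Ω × Ω => G z.1 z.2)) {h : ℝ≥0}
    (hwmp : ∀ ν : Measure Ω, IsRadon ν → ∀ M : ℝ≥0, 0 < M →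
      (∀ x ∈ ν.support, potential G ν x ≤ (M : ℝ≥0∞)) → ∀ x, potential G ν x ≤ h * M)
    {ν : Measure Ω} (hν : IsRadon ν) (hν0 : ν ≠ 0) {γ : ℝ} (hγ : 0 < γ) (hγ1 : γ < 1) :
    ∃ C : ℝ≥0∞, C ≠ ∞ ∧ ∀ x, potentialDensity G ν (fun y => potential G ν y ^ (-γ)) x ≤
      C * potential G ν x ^ (1 - γ) := by
  set w := potential G ν with hw
  have hw0 : ∀ x, 0 < w x := potential_pos hpos hlsc hν0
  have hwl : LowerSemicontinuous w := lowerSemicontinuous_potential hpos hlsc hν.innerRegular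
  set ρ : ℝ≥0∞ := 2⁻¹ with hρ
  have hρ0 : ρ ≠ 0 := by simp [hρ]
  have hρT : ρ ≠ ∞ := by simp [hρ]
  have hρ1 : ρ < 1 := by simp [hρ]
  have hq1 : ρ ^ (1 - γ) < 1 := ENNReal.rpow_lt_one hρ1 (by linarith)
  refine ⟨1 + h * ρ ^ (-γ) * (1 - ρ ^ (1 - γ))⁻¹, ?_, fun x => ?_⟩
  · refine ENNReal.add_ne_top.2 ⟨ENNReal.one_ne_top, ENNReal.mul_ne_top
      (ENNReal.mul_ne_top ENNReal.coe_ne_top ?_) ?_⟩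
    · simp [ENNReal.rpow_eq_top_iff, hρ0, hρT]
    · simpa [tsub_eq_zero_iff_le] using hq1
  rcases eq_or_ne (w x) ∞ with hT | hT
  · rw [hT, ENNReal.top_rpow_of_pos (by linarith), ENNReal.mul_top (by simp)]
    exact le_top
  set A := w x with hA
  have hA0 : A ≠ 0 := (hw0 x).ne'
  have hAρ0 : ∀ k : ℕ, A * ρ ^ k ≠ 0 := fun k => mul_ne_zero hA0 (pow_ne_zero k hρ0)
  have hAρT : ∀ k : ℕ, A * ρ ^ k ≠ ∞ := fun k => ENNReal.mul_ne_top hT (ENNReal.pow_ne_top hρT)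
  have hm : ∀ t, MeasurableSet {y | w y ≤ t} := fun t => (hwl.isClosed_preimage t).measurableSet
  -- each point of `{w ≤ A}` lies in the layer `A ρ ^ (k + 1) < w ≤ A ρ ^ k` for some `k`
  have hpt : ∀ y, w y ^ (-γ) ≤ A ^ (-γ) +
      ∑' k : ℕ, {y | w y ≤ A * ρ ^ k}.indicator (fun _ => (A * ρ ^ (k + 1)) ^ (-γ)) y := by
    intro y
    rcases lt_or_ge A (w y) with hy | hy
    · refine le_add_right ?_
      rw [ENNReal.rpow_neg, ENNReal.rpow_neg]
      exact ENNReal.inv_le_inv.2 (ENNReal.rpow_le_rpow hy.le hγ.le)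
    · have hex : ∃ k : ℕ, A * ρ ^ (k + 1) < w y := by
        have hlim : Tendsto (fun k : ℕ => A * ρ ^ (k + 1)) atTop (𝓝 (A * 0)) :=
          ENNReal.Tendsto.const_mul ((tendsto_add_atTop_iff_nat 1).2
            (ENNReal.tendsto_pow_atTop_nhds_zero_of_lt_one hρ1)) (Or.inr hT)
        rw [mul_zero] at hlim
        exact (hlim.eventually (gt_mem_nhds (hw0 y))).exists
      classical
      have hk := Nat.find_spec hex
      have hk' : w y ≤ A * ρ ^ Nat.find hex := by
        rcases Nat.eq_zero_or_pos (Nat.find hex) with h0 | h0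
        · simpa [h0] using hy
        · have := Nat.find_min hex (Nat.sub_lt h0 one_pos)
          rwa [show Nat.find hex - 1 + 1 = Nat.find hex by omega, not_lt] at this
      refine le_add_left (le_trans ?_ (ENNReal.le_tsum (Nat.find hex)))
      rw [indicator_of_mem (show y ∈ {y | w y ≤ _} from hk'), ENNReal.rpow_neg, ENNReal.rpow_neg]
      exact ENNReal.inv_le_inv.2 (ENNReal.rpow_le_rpow hk.le hγ.le)
  have hterm : ∀ k : ℕ, ∫⁻ y, G x y *
      {y | w y ≤ A * ρ ^ k}.indicator (fun _ => (A * ρ ^ (k + 1)) ^ (-γ)) y ∂ν ≤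
      h * ρ ^ (-γ) * A ^ (1 - γ) * (ρ ^ (1 - γ)) ^ k := by
    intro k
    have e1 : ∫⁻ y, G x y *
        {y | w y ≤ A * ρ ^ k}.indicator (fun _ => (A * ρ ^ (k + 1)) ^ (-γ)) y ∂ν =
        potential G (ν.restrict {y | w y ≤ A * ρ ^ k}) x * (A * ρ ^ (k + 1)) ^ (-γ) := by
      refine (potentialDensity_indicator (hm _) _ x).trans ?_
      exact lintegral_mul_const _ (measurable_kernel hlsc x)
    rw [e1]
    calc _ ≤ h * (A * ρ ^ k) * (A * ρ ^ (k + 1)) ^ (-γ) :=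
          mul_le_mul_left (potential_restrict_sublevel_le hpos hlsc hwmp hν (hAρ0 k) (hAρT k) x) _
      _ = h * (A * ρ ^ k) * ((A * ρ ^ k) ^ (-γ) * ρ ^ (-γ)) := by
          rw [pow_succ, ← mul_assoc A, ENNReal.mul_rpow_of_ne_top (hAρT k) hρT]
      _ = h * ρ ^ (-γ) * ((A * ρ ^ k) ^ (1 : ℝ) * (A * ρ ^ k) ^ (-γ)) := by
          rw [ENNReal.rpow_one]; ring
      _ = h * ρ ^ (-γ) * (A * ρ ^ k) ^ (1 - γ) := by
          rw [← ENNReal.rpow_add _ _ (hAρ0 k) (hAρT k), ← sub_eq_add_neg]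
      _ = h * ρ ^ (-γ) * A ^ (1 - γ) * (ρ ^ (1 - γ)) ^ k := by
          rw [ENNReal.mul_rpow_of_nonneg _ _ (by linarith), ← ENNReal.rpow_natCast,
            ← ENNReal.rpow_natCast, ← ENNReal.rpow_mul, ← ENNReal.rpow_mul,
            mul_comm (1 - γ), mul_assoc (h * ρ ^ (-γ))]
  calc potentialDensity G ν (fun y => w y ^ (-γ)) x
      ≤ ∫⁻ y, (G x y * A ^ (-γ) + ∑' k : ℕ, G x y *
          {y | w y ≤ A * ρ ^ k}.indicator (fun _ => (A * ρ ^ (k + 1)) ^ (-γ)) y) ∂ν := by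
        refine lintegral_mono fun y => ?_
        rw [ENNReal.tsum_mul_left, ← mul_add]
        exact mul_le_mul_right (hpt y) _
    _ = A * A ^ (-γ) + ∑' k : ℕ, ∫⁻ y, G x y *
          {y | w y ≤ A * ρ ^ k}.indicator (fun _ => (A * ρ ^ (k + 1)) ^ (-γ)) y ∂ν := by
        rw [lintegral_add_left ((measurable_kernel hlsc x).mul_const _),
          lintegral_mul_const _ (measurable_kernel hlsc x), lintegral_tsum]
        · rfl
        · exact fun k => ((measurable_kernel hlsc x).mul
            (measurable_const.indicator (hm _))).aemeasurable
    _ ≤ A ^ (1 - γ) + ∑' k : ℕ, h * ρ ^ (-γ) * A ^ (1 - γ) * (ρ ^ (1 - γ)) ^ k := by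
        refine add_le_add (le_of_eq ?_) (ENNReal.tsum_le_tsum hterm)
        rw [sub_eq_add_neg, ENNReal.rpow_add _ _ hA0 hT, ENNReal.rpow_one]
    _ = (1 + h * ρ ^ (-γ) * (1 - ρ ^ (1 - γ))⁻¹) * A ^ (1 - γ) := by
        rw [ENNReal.tsum_mul_left, ENNReal.tsum_geometric]
        ring

/-! ### From the integral condition to the norm inequality -/

lemma isRadon_withDensity_of_le [T2Space Ω] [BorelSpace Ω] {σ : Measure Ω} (hσ : IsRadon σ)
    {f : Ω → ℝ≥0∞} (hf : Measurable f) {c : ℝ≥0} (hfc : ∀ x, f x ≤ c) :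
    IsRadon (σ.withDensity f) := by
  refine ⟨?_, innerRegular_withDensity hσ.innerRegular hf⟩
  have := hσ.locallyFinite
  have : IsLocallyFiniteMeasure (c • σ) := inferInstance
  refine Measure.isLocallyFiniteMeasure_of_le (μ := c • σ) ?_
  calc σ.withDensity f ≤ σ.withDensity fun _ => (c : ℝ≥0∞) :=
        withDensity_mono (Eventually.of_forall hfc)
    _ = c • σ := by rw [withDensity_const]; rfl

/-- The case `r < 1`. Hölder's inequality passes from `L^r` to the weighted `L¹` norm with weight
`w ^ (-γ)`, `w = Gσ`; there the operator can be moved onto the weight, and `G(w ^ (-γ) σ)` is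
at most a multiple of `w ^ (1 - γ)`. The value of `γ` makes both Hölder steps end in `∫ w ^ s`. -/
theorem exists_bound_of_lt_one [T2Space Ω] [BorelSpace Ω] (hpos : ∀ x y, 0 < G x y)
    (hlsc : LowerSemicontinuous (fun z : Ω × Ω => G z.1 z.2)) {a h : ℝ≥0}
    (hsymm : ∀ x y, G x y ≤ a * G y x)
    (hwmp : ∀ ν : Measure Ω, IsRadon ν → ∀ M : ℝ≥0, 0 < M →
      (∀ x ∈ ν.support, potential G ν x ≤ (M : ℝ≥0∞)) → ∀ x, potential G ν x ≤ h * M)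
    {σ : Measure Ω} (hσ : IsRadon σ) (hσ0 : σ ≠ 0) {p r : ℝ} (hp : 1 < p) (hr : 0 < r)
    (hr1 : r < 1) (hW : ∫⁻ x, potential G σ x ^ (p * r / (p - r)) ∂σ < ∞) :
    ∃ C : ℝ≥0∞, C ≠ ∞ ∧ ∀ f : Ω → ℝ≥0∞, Measurable f →
      (∫⁻ x, potentialDensity G σ f x ^ r ∂σ) ^ (1 / r) ≤ C * (∫⁻ x, f x ^ p ∂σ) ^ (1 / p) := by
  set w := potential G σ with hw
  set s := p * r / (p - r) with hs
  have hpr : 0 < p - r := by linarith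
  have hs0 : 0 < s := by positivity
  set γ := p * (1 - r) / (p - r) with hγ
  have hγ0 : 0 < γ := div_pos (mul_pos (by linarith) (by linarith)) hpr
  have hγ1 : γ < 1 := by rw [hγ, div_lt_one hpr]; nlinarith
  obtain ⟨C, hC, hCw⟩ := exists_potentialDensity_rpow_neg_le hpos hlsc hwmp hσ hσ0 hγ0 hγ1
  rw [← hw] at hCw
  have hwm : Measurable w := (lowerSemicontinuous_potential hpos hlsc hσ.innerRegular).measurable
  have hw0 : ∀ x, 0 < w x := potential_pos hpos hlsc hσ0
  have hwT : ∀ᵐ x ∂σ, w x < ∞ := by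
    filter_upwards [ae_lt_top (hwm.pow_const s) hW.ne] with x hx
    exact (ENNReal.rpow_lt_top_iff_of_pos hs0).1 hx
  set W := ∫⁻ x, w x ^ s ∂σ with hWdef
  have hp0 : 0 ≤ 1 - 1 / p := by
    rw [sub_nonneg, div_le_one (by linarith)]; exact hp.le
  refine ⟨a * C * W ^ (1 - 1 / p) * W ^ ((1 - r) / r), ?_, fun f hf => ?_⟩
  · refine ENNReal.mul_ne_top (ENNReal.mul_ne_top (ENNReal.mul_ne_top ENNReal.coe_ne_top hC) ?_) ?_
    · exact ENNReal.rpow_ne_top_of_nonneg hp0 hW.ne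
    · exact ENNReal.rpow_ne_top_of_nonneg (div_nonneg (by linarith) hr.le) hW.ne
  set u := potentialDensity G σ f with hu
  have hum : Measurable u :=
    (lowerSemicontinuous_potentialDensity hpos hlsc hσ.innerRegular hf).measurable
  have hfw : ∫⁻ x, f x * w x ^ (1 - γ) ∂σ ≤ (∫⁻ x, f x ^ p ∂σ) ^ (1 / p) * W ^ (1 - 1 / p) := by
    have := ENNReal.lintegral_mul_norm_pow_le (μ := σ) (hf.pow_const p).aemeasurable
      (hwm.pow_const s).aemeasurable (p := 1 / p) (q := 1 - 1 / p) (by positivity) hp0 (by ring)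
    refine le_trans (le_of_eq (lintegral_congr fun x => ?_)) this
    rw [← ENNReal.rpow_mul, ← ENNReal.rpow_mul, mul_one_div_cancel (by linarith),
      ENNReal.rpow_one]
    congr 2
    rw [hs, hγ]
    field_simp
    ring
  have hU : ∫⁻ x, u x * w x ^ (-γ) ∂σ ≤
      a * C * W ^ (1 - 1 / p) * (∫⁻ x, f x ^ p ∂σ) ^ (1 / p) := by
    calc ∫⁻ x, u x * w x ^ (-γ) ∂σ
        ≤ a * ∫⁻ y, f y * potentialDensity G σ (fun y => w y ^ (-γ)) y ∂σ :=
          lintegral_potentialDensity_mul_le hpos hlsc hsymm hσ.innerRegular hf (hwm.pow_const _)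
      _ ≤ a * ∫⁻ y, C * (f y * w y ^ (1 - γ)) ∂σ := by
          refine mul_le_mul_right (lintegral_mono fun y => ?_) _
          rw [mul_left_comm]
          exact mul_le_mul_right (hCw y) _
      _ = a * C * ∫⁻ y, f y * w y ^ (1 - γ) ∂σ := by
          rw [lintegral_const_mul _ (show Measurable fun y => f y * w y ^ (1 - γ) from
            hf.mul (hwm.pow_const _)), mul_assoc]
      _ ≤ a * C * ((∫⁻ x, f x ^ p ∂σ) ^ (1 / p) * W ^ (1 - 1 / p)) := mul_le_mul_right hfw _
      _ = _ := by ring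
  have hur : ∫⁻ x, u x ^ r ∂σ ≤ (∫⁻ x, u x * w x ^ (-γ) ∂σ) ^ r * W ^ (1 - r) := by
    have := ENNReal.lintegral_mul_norm_pow_le (μ := σ) (hum.mul (hwm.pow_const (-γ))).aemeasurable
      (hwm.pow_const s).aemeasurable (p := r) (q := 1 - r) hr.le (by linarith) (by ring)
    refine le_trans (le_of_eq (lintegral_congr_ae ?_)) this
    filter_upwards [hwT] with x hx
    simp only [Pi.mul_apply]
    rw [ENNReal.mul_rpow_of_nonneg _ _ hr.le, ← ENNReal.rpow_mul, ← ENNReal.rpow_mul, mul_assoc,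
      ← ENNReal.rpow_add _ _ (hw0 x).ne' hx.ne]
    have : -γ * r + s * (1 - r) = 0 := by
      rw [hs, hγ]; field_simp; ring
    rw [this, ENNReal.rpow_zero, mul_one]
  calc (∫⁻ x, u x ^ r ∂σ) ^ (1 / r)
      ≤ ((∫⁻ x, u x * w x ^ (-γ) ∂σ) ^ r * W ^ (1 - r)) ^ (1 / r) :=
        ENNReal.rpow_le_rpow hur (by positivity)
    _ = (∫⁻ x, u x * w x ^ (-γ) ∂σ) * W ^ ((1 - r) / r) := by
        rw [ENNReal.mul_rpow_of_nonneg _ _ (by positivity), ← ENNReal.rpow_mul,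
          ← ENNReal.rpow_mul, mul_one_div_cancel hr.ne', ENNReal.rpow_one, mul_one_div]
    _ ≤ a * C * W ^ (1 - 1 / p) * (∫⁻ x, f x ^ p ∂σ) ^ (1 / p) * W ^ ((1 - r) / r) :=
        mul_le_mul_left hU _
    _ = _ := by ring

/-- The case `r ≥ 1`, for bounded `f` and under the a priori assumption that the left-hand side is
finite: `u = G(fσ)` satisfies `u ^ r ≤ κ G(u ^ (r - 1) f σ)`, and after moving the operator onto
the constant `1` Hölder's inequality with exponents `r / (r - 1)`, `p`, `s` allows a positive power
of `∫ u ^ r` to be cancelled. -/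
theorem lintegral_rpow_potentialDensity_le_of_finite [T2Space Ω] [BorelSpace Ω]
    (hpos : ∀ x y, 0 < G x y)
    (hlsc : LowerSemicontinuous (fun z : Ω × Ω => G z.1 z.2)) {a h : ℝ≥0} (hh : 1 ≤ h)
    (hsymm : ∀ x y, G x y ≤ a * G y x)
    (hwmp : ∀ ν : Measure Ω, IsRadon ν → ∀ M : ℝ≥0, 0 < M →
      (∀ x ∈ ν.support, potential G ν x ≤ (M : ℝ≥0∞)) → ∀ x, potential G ν x ≤ h * M)
    {σ : Measure Ω} (hσ : IsRadon σ) {p r : ℝ} (hr : 1 ≤ r) (hrp : r < p)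
    {f : Ω → ℝ≥0∞} (hf : Measurable f) {c : ℝ≥0} (hfc : ∀ x, f x ≤ c)
    (hfin : ∫⁻ x, potentialDensity G σ f x ^ r ∂σ ≠ ∞) :
    (∫⁻ x, potentialDensity G σ f x ^ r ∂σ) ^ (1 / r) ≤
      2 * (2 * h) ^ (r - 1) * a *
        (∫⁻ x, potential G σ x ^ (p * r / (p - r)) ∂σ) ^ (1 / r - 1 / p) *
        (∫⁻ x, f x ^ p ∂σ) ^ (1 / p) := by
  have hp0 : 0 < p := by linarith
  have hr0 : 0 < r := by linarith
  have hpr : 0 < p - r := by linarith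
  set κ : ℝ≥0∞ := 2 * (2 * h) ^ (r - 1) with hκ
  set w := potential G σ with hw
  set u := potentialDensity G σ f with hu
  have hwm : Measurable w := (lowerSemicontinuous_potential hpos hlsc hσ.innerRegular).measurable
  have hum : Measurable u :=
    (lowerSemicontinuous_potentialDensity hpos hlsc hσ.innerRegular hf).measurable
  have hfu : Measurable fun x => f x * u x ^ (r - 1) := hf.mul (hum.pow_const _)
  have hu' : potential G (σ.withDensity f) = u :=
    (funext (potentialDensity_eq_potential_withDensity hlsc hf)).symm
  have hpt : ∀ x, u x ^ r ≤ κ * potentialDensity G σ (fun y => f y * u y ^ (r - 1)) x := by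
    intro x
    have := rpow_potential_le hpos hlsc hh hwmp (isRadon_withDensity_of_le hσ hf hfc) hr x
    rw [hu'] at this
    refine this.trans (mul_le_mul_right (le_of_eq ?_) _)
    rw [potentialDensity, lintegral_withDensity_eq_lintegral_mul σ hf
      (show Measurable fun y => G x y * u y ^ (r - 1) from
        (measurable_kernel hlsc x).mul (hum.pow_const _))]
    exact lintegral_congr fun y => mul_left_comm _ _ _
  have hX : ∫⁻ x, u x ^ r ∂σ ≤ κ * (a * ∫⁻ x, f x * u x ^ (r - 1) * w x ∂σ) := by
    calc ∫⁻ x, u x ^ r ∂σ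
        ≤ ∫⁻ x, κ * potentialDensity G σ (fun y => f y * u y ^ (r - 1)) x ∂σ := lintegral_mono hpt
      _ = κ * ∫⁻ x, potentialDensity G σ (fun y => f y * u y ^ (r - 1)) x * 1 ∂σ := by
          simp only [mul_one]
          exact lintegral_const_mul _
            (lowerSemicontinuous_potentialDensity hpos hlsc hσ.innerRegular hfu).measurable
      _ ≤ _ := by
          have := lintegral_potentialDensity_mul_le hpos hlsc hsymm hσ.innerRegular hfu
            (measurable_const (a := (1 : ℝ≥0∞)))
          rw [potentialDensity_one] at this
          exact mul_le_mul_right this _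
  have hH : ∫⁻ x, f x * u x ^ (r - 1) * w x ∂σ ≤ (∫⁻ x, u x ^ r ∂σ) ^ (1 - 1 / r) *
      (∫⁻ x, f x ^ p ∂σ) ^ (1 / p) * (∫⁻ x, w x ^ (p * r / (p - r)) ∂σ) ^ (1 / r - 1 / p) := by
    have := ENNReal.lintegral_prod_norm_pow_le (μ := σ) (Finset.univ : Finset (Fin 3))
      (f := ![fun x => u x ^ r, fun x => f x ^ p, fun x => w x ^ (p * r / (p - r))])
      (p := ![1 - 1 / r, 1 / p, 1 / r - 1 / p]) ?_ ?_ ?_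
    · simp only [Fin.prod_univ_three, Matrix.cons_val_zero, Matrix.cons_val_one,
        Matrix.cons_val_two, Matrix.tail_cons, Matrix.head_cons] at this
      refine le_trans (le_of_eq (lintegral_congr fun x => ?_)) this
      rw [← ENNReal.rpow_mul, ← ENNReal.rpow_mul, ← ENNReal.rpow_mul,
        mul_one_div_cancel hp0.ne', ENNReal.rpow_one, mul_comm (f x)]
      have e1 : r * (1 - 1 / r) = r - 1 := by field_simp
      have e2 : p * r / (p - r) * (1 / r - 1 / p) = 1 := by field_simp
      rw [e1, e2, ENNReal.rpow_one]
    · intro i _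
      fin_cases i
      · exact (hum.pow_const _).aemeasurable
      · exact (hf.pow_const _).aemeasurable
      · exact (hwm.pow_const _).aemeasurable
    · simp [Fin.sum_univ_three]
    · intro i _
      fin_cases i
      · simpa using inv_le_one_of_one_le₀ hr
      · simpa using hp0.le
      · simpa using inv_anti₀ hr0 hrp.le
  rcases eq_or_ne (∫⁻ x, u x ^ r ∂σ) 0 with h0 | h0
  · rw [h0, ENNReal.zero_rpow_of_pos (by positivity)]
    exact zero_le
  have hX0 : (∫⁻ x, u x ^ r ∂σ) ^ (1 - 1 / r) ≠ 0 := by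
    simp [ENNReal.rpow_eq_zero_iff, h0, hfin]
  have hXT : (∫⁻ x, u x ^ r ∂σ) ^ (1 - 1 / r) ≠ ∞ := by
    simp [ENNReal.rpow_eq_top_iff, h0, hfin]
  rw [← ENNReal.mul_le_mul_iff_right hX0 hXT, ← ENNReal.rpow_add _ _ h0 hfin]
  calc (∫⁻ x, u x ^ r ∂σ) ^ (1 - 1 / r + 1 / r) = ∫⁻ x, u x ^ r ∂σ := by
        rw [sub_add_cancel, ENNReal.rpow_one]
    _ ≤ κ * (a * ∫⁻ x, f x * u x ^ (r - 1) * w x ∂σ) := hX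
    _ ≤ _ := mul_le_mul_right (mul_le_mul_right hH _) _
    _ = _ := by ring

/-- The case `r ≥ 1`. With `k = min 1 (w ^ (s - 1))` the potential of `k` lies in `L¹` and below
`w ∈ L^s`, hence in `L^r`; the truncations `min f (n k)` therefore meet the a priori assumption. -/
theorem exists_bound_of_one_le [T2Space Ω] [BorelSpace Ω] (hpos : ∀ x y, 0 < G x y)
    (hlsc : LowerSemicontinuous (fun z : Ω × Ω => G z.1 z.2)) {a h : ℝ≥0} (hh : 1 ≤ h)
    (hsymm : ∀ x y, G x y ≤ a * G y x)
    (hwmp : ∀ ν : Measure Ω, IsRadon ν → ∀ M : ℝ≥0, 0 < M →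
      (∀ x ∈ ν.support, potential G ν x ≤ (M : ℝ≥0∞)) → ∀ x, potential G ν x ≤ h * M)
    {σ : Measure Ω} (hσ : IsRadon σ) (hσ0 : σ ≠ 0) {p r : ℝ} (hr : 1 ≤ r) (hrp : r < p)
    (hW : ∫⁻ x, potential G σ x ^ (p * r / (p - r)) ∂σ < ∞) :
    ∃ C : ℝ≥0∞, C ≠ ∞ ∧ ∀ f : Ω → ℝ≥0∞, Measurable f →
      (∫⁻ x, potentialDensity G σ f x ^ r ∂σ) ^ (1 / r) ≤ C * (∫⁻ x, f x ^ p ∂σ) ^ (1 / p) := by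
  have hp0 : 0 < p := by linarith
  have hr0 : 0 < r := by linarith
  have hpr : 0 < p - r := by linarith
  have hexp : 0 ≤ 1 / r - 1 / p := by simpa using inv_anti₀ hr0 hrp.le
  refine ⟨2 * (2 * h) ^ (r - 1) * a *
    (∫⁻ x, potential G σ x ^ (p * r / (p - r)) ∂σ) ^ (1 / r - 1 / p), ?_, fun f hf => ?_⟩
  · refine ENNReal.mul_ne_top (ENNReal.mul_ne_top (ENNReal.mul_ne_top (by simp) ?_)
      ENNReal.coe_ne_top) (ENNReal.rpow_ne_top_of_nonneg hexp hW.ne)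
    exact ENNReal.rpow_ne_top_of_nonneg (by linarith)
      (ENNReal.mul_ne_top (by simp) ENNReal.coe_ne_top)
  set D := 2 * (2 * h : ℝ≥0∞) ^ (r - 1) * a *
    (∫⁻ x, potential G σ x ^ (p * r / (p - r)) ∂σ) ^ (1 / r - 1 / p) with hD
  set w := potential G σ with hw
  set s := p * r / (p - r) with hs
  have hrs : r ≤ s := by
    rw [hs, le_div_iff₀ hpr]; nlinarith
  have hwm : Measurable w := (lowerSemicontinuous_potential hpos hlsc hσ.innerRegular).measurable
  have hw0 : ∀ x, 0 < w x := potential_pos hpos hlsc hσ0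
  set k : Ω → ℝ≥0∞ := fun x => min 1 (w x ^ (s - 1)) with hk
  have hkm : Measurable k := measurable_const.min (hwm.pow_const _)
  have hk0 : ∀ x, k x ≠ 0 := fun x => by
    refine (lt_min zero_lt_one ?_).ne'
    exact ENNReal.rpow_pos_of_nonneg (hw0 x) (by linarith)
  have hpot : ∀ {g : Ω → ℝ≥0∞}, Measurable g → Measurable (potentialDensity G σ g) := fun hg =>
    (lowerSemicontinuous_potentialDensity hpos hlsc hσ.innerRegular hg).measurable
  have hGk1 : ∫⁻ x, potentialDensity G σ k x ∂σ ≤ a * ∫⁻ x, w x ^ s ∂σ := by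
    have h1 := lintegral_potentialDensity_mul_le hpos hlsc hsymm hσ.innerRegular hkm
      (measurable_const (a := (1 : ℝ≥0∞)))
    rw [potentialDensity_one] at h1
    simp only [mul_one] at h1
    refine h1.trans (mul_le_mul_right (lintegral_mono fun y => ?_) _)
    calc k y * w y ≤ w y ^ (s - 1) * w y ^ (1 : ℝ) := by
          rw [ENNReal.rpow_one]; exact mul_le_mul_left (min_le_right _ _) _
      _ = w y ^ s := by
          rw [← ENNReal.rpow_add_of_nonneg _ _ (by linarith) zero_le_one, sub_add_cancel]
  have hGkr : ∫⁻ x, potentialDensity G σ k x ^ r ∂σ < ∞ := by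
    calc ∫⁻ x, potentialDensity G σ k x ^ r ∂σ
        ≤ ∫⁻ x, (potentialDensity G σ k x + w x ^ s) ∂σ := by
          refine lintegral_mono fun x => ?_
          rcases le_total (potentialDensity G σ k x) 1 with h1 | h1
          · exact le_add_right (ENNReal.rpow_le_self_of_le_one h1 hr)
          · refine le_add_left ((ENNReal.rpow_le_rpow_of_exponent_le h1 hrs).trans
              (ENNReal.rpow_le_rpow ?_ (by linarith)))
            rw [hw, ← potentialDensity_one]
            exact potentialDensity_mono (Eventually.of_forall fun y => min_le_left _ _) x
      _ = ∫⁻ x, potentialDensity G σ k x ∂σ + ∫⁻ x, w x ^ s ∂σ := lintegral_add_left (hpot hkm) _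
      _ < ∞ := ENNReal.add_lt_top.2
          ⟨hGk1.trans_lt (ENNReal.mul_lt_top ENNReal.coe_lt_top hW), hW⟩
  set F : ℕ → Ω → ℝ≥0∞ := fun n x => min (f x) (n * k x) with hF
  have hFm : ∀ n, Measurable (F n) := fun n => hf.min (hkm.const_mul _)
  have hFmono : Monotone F := fun m n hmn x =>
    min_le_min le_rfl (mul_le_mul_left (by exact_mod_cast hmn) _)
  have hFsup : (fun x => ⨆ n, F n x) = f := by
    ext x
    simp only [hF]
    rw [← inf_iSup_eq, ← ENNReal.iSup_mul, ENNReal.iSup_natCast, ENNReal.top_mul (hk0 x),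
      inf_top_eq]
  have hFn : ∀ n, ∫⁻ x, potentialDensity G σ (F n) x ^ r ∂σ ≤
      (D * (∫⁻ x, f x ^ p ∂σ) ^ (1 / p)) ^ r := by
    intro n
    have hfin : ∫⁻ x, potentialDensity G σ (F n) x ^ r ∂σ < ∞ := by
      calc ∫⁻ x, potentialDensity G σ (F n) x ^ r ∂σ
          ≤ ∫⁻ x, (n : ℝ≥0∞) ^ r * potentialDensity G σ k x ^ r ∂σ := by
            refine lintegral_mono fun x => ?_
            rw [← ENNReal.mul_rpow_of_nonneg _ _ hr0.le, ← potentialDensity_const_mul hlsc hkm]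
            exact ENNReal.rpow_le_rpow
              (potentialDensity_mono (Eventually.of_forall fun y => min_le_right _ _) x) hr0.le
        _ = (n : ℝ≥0∞) ^ r * ∫⁻ x, potentialDensity G σ k x ^ r ∂σ :=
            lintegral_const_mul _ ((hpot hkm).pow_const _)
        _ < ∞ := ENNReal.mul_lt_top
            (ENNReal.rpow_lt_top_of_nonneg hr0.le (ENNReal.natCast_ne_top n)) hGkr
    have hbd : ∀ x, F n x ≤ ((n : ℝ≥0) : ℝ≥0∞) := fun x => by
      refine (min_le_right _ _).trans ?_
      calc (n : ℝ≥0∞) * k x ≤ n * 1 := mul_le_mul_right (min_le_left _ _) _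
        _ = ((n : ℝ≥0) : ℝ≥0∞) := by simp
    have := lintegral_rpow_potentialDensity_le_of_finite hpos hlsc hh hsymm hwmp hσ hr hrp
      (hFm n) hbd hfin.ne
    rw [one_div, ENNReal.rpow_inv_le_iff hr0, ← one_div] at this
    refine this.trans (ENNReal.rpow_le_rpow (mul_le_mul_right (ENNReal.rpow_le_rpow
      (lintegral_mono fun x => ENNReal.rpow_le_rpow (min_le_left _ _) hp0.le)
      (by positivity)) _) hr0.le)
  rw [one_div r, ENNReal.rpow_inv_le_iff hr0]
  have hlim : ∀ x, potentialDensity G σ f x ^ r = ⨆ n, potentialDensity G σ (F n) x ^ r := by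
    intro x
    conv_lhs => rw [← hFsup, potentialDensity_iSup hlsc hFm hFmono x]
    exact iSup_rpow hr0 _
  simp_rw [hlim]
  rw [lintegral_iSup (fun n => (hpot (hFm n)).pow_const _) fun m n hmn x => ENNReal.rpow_le_rpow
    (potentialDensity_mono (Eventually.of_forall (hFmono hmn)) x) hr0.le]
  exact iSup_le hFn

/-! ### The norm inequality for nonnegative functions -/

lemma eLpNorm_ofReal_eq {Ω E : Type*} [MeasurableSpace Ω] [ENorm E] {σ : Measure Ω} {p : ℝ}
    (hp : 0 < p) (f : Ω → E) :
    eLpNorm f (ENNReal.ofReal p) σ = (∫⁻ x, ‖f x‖ₑ ^ p ∂σ) ^ (1 / p) := by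
  rw [eLpNorm_eq_lintegral_rpow_enorm_toReal (by simpa using hp) ENNReal.ofReal_ne_top,
    ENNReal.toReal_ofReal hp.le]

lemma enorm_toReal_eq {a : ℝ≥0∞} (ha : a ≠ ∞) : ‖a.toReal‖ₑ = a := by
  rw [← ofReal_norm, Real.norm_of_nonneg ENNReal.toReal_nonneg, ENNReal.ofReal_toReal ha]

lemma ae_lt_top_of_lintegral_rpow_lt_top {Ω : Type*} [MeasurableSpace Ω] {σ : Measure Ω} {r : ℝ}
    (hr : 0 < r) {u : Ω → ℝ≥0∞} (hu : Measurable u) (h : ∫⁻ x, u x ^ r ∂σ < ∞) :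
    ∀ᵐ x ∂σ, u x < ∞ := by
  filter_upwards [ae_lt_top (hu.pow_const r) h.ne] with x hx
  exact (ENNReal.rpow_lt_top_iff_of_pos hr).1 hx

lemma memLp_toReal {Ω : Type*} [MeasurableSpace Ω] {σ : Measure Ω} {r : ℝ} (hr : 0 < r)
    {u : Ω → ℝ≥0∞} (hu : Measurable u) (h : ∫⁻ x, u x ^ r ∂σ < ∞) :
    MemLp (fun x => (u x).toReal) (ENNReal.ofReal r) σ := by
  refine ⟨hu.ennreal_toReal.aestronglyMeasurable, ?_⟩
  rw [eLpNorm_ofReal_eq hr]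
  refine ENNReal.rpow_lt_top_of_nonneg (by positivity) (ne_of_lt ?_)
  refine lt_of_le_of_lt (le_of_eq (lintegral_congr_ae ?_)) h
  filter_upwards [ae_lt_top_of_lintegral_rpow_lt_top hr hu h] with x hx
  rw [enorm_toReal_eq hx.ne]

theorem weightedNormInequality_of_bound [T2Space Ω] [BorelSpace Ω] (hpos : ∀ x y, 0 < G x y)
    (hlsc : LowerSemicontinuous (fun z : Ω × Ω => G z.1 z.2)) {σ : Measure Ω}
    (hσ : σ.InnerRegular) {p r : ℝ} (hp : 0 < p) (hr : 0 < r) {C : ℝ≥0∞} (hC : C ≠ ∞)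
    (H : ∀ f : Ω → ℝ≥0∞, Measurable f →
      (∫⁻ x, potentialDensity G σ f x ^ r ∂σ) ^ (1 / r) ≤ C * (∫⁻ x, f x ^ p ∂σ) ^ (1 / p)) :
    WeightedNormInequality G σ p r := by
  refine ⟨C.toNNReal + 1, by positivity, fun f hf => ?_⟩
  have hfe : AEMeasurable (fun x => ‖f x‖ₑ) σ := hf.1.enorm
  have hcongr := potentialDensity_congr (G := G) hfe.ae_eq_mk
  have hg := hfe.measurable_mk
  have hLp : eLpNorm f (ENNReal.ofReal p) σ = (∫⁻ x, hfe.mk _ x ^ p ∂σ) ^ (1 / p) := by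
    rw [eLpNorm_ofReal_eq hp]
    congr 1
    exact lintegral_congr_ae (hfe.ae_eq_mk.mono fun x hx => by simp only [← hx])
  have hb : (∫⁻ x, potentialDensity G σ (fun y => ‖f y‖ₑ) x ^ r ∂σ) ^ (1 / r) ≤
      C * eLpNorm f (ENNReal.ofReal p) σ := by
    rw [hcongr, hLp]
    exact H _ hg
  constructor
  · rw [hcongr] at hb ⊢
    refine ae_lt_top_of_lintegral_rpow_lt_top hr
      (lowerSemicontinuous_potentialDensity hpos hlsc hσ hg).measurable ?_
    have := hb.trans_lt (ENNReal.mul_lt_top hC.lt_top hf.2)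
    exact (ENNReal.rpow_lt_top_iff_of_pos (by positivity)).1 this
  · rw [eLpNorm_ofReal_eq hr]
    calc (∫⁻ x, ‖kernelOperator G σ f x‖ₑ ^ r ∂σ) ^ (1 / r)
        ≤ (∫⁻ x, potentialDensity G σ (fun y => ‖f y‖ₑ) x ^ r ∂σ) ^ (1 / r) := by
          refine ENNReal.rpow_le_rpow (lintegral_mono fun x => ENNReal.rpow_le_rpow ?_ hr.le)
            (by positivity)
          refine (enorm_integral_le_lintegral_enorm _).trans (lintegral_mono fun y => ?_)
          rw [enorm_mul]
          refine mul_le_mul_left ?_ _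
          rw [← ofReal_norm, Real.norm_of_nonneg ENNReal.toReal_nonneg]
          exact ENNReal.ofReal_toReal_le
      _ ≤ C * eLpNorm f (ENNReal.ofReal p) σ := hb
      _ ≤ _ := by
          refine mul_le_mul_left ?_ _
          rw [ENNReal.coe_add, ENNReal.coe_toNNReal hC]
          exact le_self_add

theorem exists_bound_of_weightedNormInequality [BorelSpace Ω]
    (hlsc : LowerSemicontinuous (fun z : Ω × Ω => G z.1 z.2)) {σ : Measure Ω}
    {p r : ℝ} (hp : 0 < p) (hr : 0 < r) (H : WeightedNormInequality G σ p r) :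
    ∃ C : ℝ≥0, ∀ f : Ω → ℝ≥0∞, Measurable f → ∫⁻ x, f x ^ p ∂σ < ∞ →
      (∫⁻ x, potentialDensity G σ f x ^ r ∂σ) ^ (1 / r) ≤ C * (∫⁻ x, f x ^ p ∂σ) ^ (1 / p) := by
  obtain ⟨C, -, H⟩ := H
  refine ⟨C, fun f hf hfp => ?_⟩
  have hfin := ae_lt_top_of_lintegral_rpow_lt_top hp hf hfp
  have hae : (fun y => ‖(f y).toReal‖ₑ) =ᵐ[σ] f :=
    hfin.mono fun x hx => enorm_toReal_eq hx.ne
  obtain ⟨h1, h2⟩ := H _ (memLp_toReal hp hf hfp)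
  rw [potentialDensity_congr hae] at h1
  rw [eLpNorm_ofReal_eq hr, eLpNorm_ofReal_eq hp] at h2
  convert h2 using 2
  · refine lintegral_congr_ae (h1.mono fun x hx => ?_)
    have hx' : ∀ᵐ y ∂σ, G x y * f y < ∞ :=
      ae_lt_top ((measurable_kernel hlsc x).mul hf) hx.ne
    have : kernelOperator G σ (fun y => (f y).toReal) x = (potentialDensity G σ f x).toReal := by
      rw [kernelOperator, potentialDensity,
        ← integral_toReal (f := fun y => G x y * f y)
          ((measurable_kernel hlsc x).mul hf).aemeasurable hx']
      simp only [ENNReal.toReal_mul]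
    simp only [this, enorm_toReal_eq hx.ne]
  · congr 1
    exact lintegral_congr_ae (hae.mono fun x hx => congrArg (· ^ p) hx.symm)

/-! ### From the norm inequality to a supersolution -/

lemma add_rpow_le_two_rpow_mul {r : ℝ} (hr : 0 < r) (a b : ℝ≥0∞) :
    (a + b) ^ r ≤ 2 ^ r * (a ^ r + b ^ r) := by
  wlog h : a ≤ b generalizing a b
  · rw [add_comm a, add_comm (a ^ r)]
    exact this b a (le_of_not_ge h)
  calc (a + b) ^ r ≤ (2 * b) ^ r := by
        refine ENNReal.rpow_le_rpow ?_ hr.le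
        rw [two_mul]; gcongr
    _ = 2 ^ r * b ^ r := ENNReal.mul_rpow_of_nonneg _ _ hr.le
    _ ≤ _ := mul_le_mul_right le_add_self _

lemma exists_isCompact_measure_pos {σ : Measure Ω} (hσ : IsRadon σ) (hσ0 : σ ≠ 0) :
    ∃ K, IsCompact K ∧ 0 < σ K ∧ σ K < ∞ := by
  obtain ⟨K, -, hK, h⟩ := hσ.innerRegular.innerRegular MeasurableSet.univ 0
    (Measure.measure_univ_pos.2 hσ0)
  have := hσ.locallyFinite
  exact ⟨K, hK, h, hK.measure_lt_top⟩

/-- The norm inequality with exponents `(r / q, r)` produces a positive supersolution in `L^r`: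
with `g = G(1_K σ)` for a compact set `K` of positive measure, the iterates of
`u ↦ g + G(u ^ q σ)` started at `0` increase, and they stay bounded in `L^r` because `q < 1`. -/
theorem exists_supersolution_of_bound [T2Space Ω] [BorelSpace Ω] (hpos : ∀ x y, 0 < G x y)
    (hlsc : LowerSemicontinuous (fun z : Ω × Ω => G z.1 z.2))
    {σ : Measure Ω} (hσ : IsRadon σ) (hσ0 : σ ≠ 0) {q r : ℝ} (hq : 0 < q) (hq1 : q < 1)
    (hr : 0 < r) {C : ℝ≥0} (H : ∀ f : Ω → ℝ≥0∞, Measurable f → ∫⁻ x, f x ^ (r / q) ∂σ < ∞ →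
      (∫⁻ x, potentialDensity G σ f x ^ r ∂σ) ^ (1 / r) ≤
        C * (∫⁻ x, f x ^ (r / q) ∂σ) ^ (1 / (r / q))) :
    ∃ u : Ω → ℝ≥0∞, Measurable u ∧ (∀ x, 0 < u x) ∧ ∫⁻ x, u x ^ r ∂σ < ∞ ∧
      ∀ x, potentialDensity G σ (fun y => u y ^ q) x ≤ u x := by
  have hpot : ∀ {g : Ω → ℝ≥0∞}, Measurable g → Measurable (potentialDensity G σ g) := fun hg =>
    (lowerSemicontinuous_potentialDensity hpos hlsc hσ.innerRegular hg).measurable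
  have hrq : 0 < r / q := div_pos hr hq
  have H' : ∀ f : Ω → ℝ≥0∞, Measurable f → ∫⁻ x, f x ^ (r / q) ∂σ < ∞ →
      ∫⁻ x, potentialDensity G σ f x ^ r ∂σ ≤ C ^ r * (∫⁻ x, f x ^ (r / q) ∂σ) ^ q := by
    intro f hf hfin
    have := H f hf hfin
    rw [one_div r, ENNReal.rpow_inv_le_iff hr, ENNReal.mul_rpow_of_nonneg _ _ hr.le,
      ← ENNReal.rpow_mul] at this
    rwa [show 1 / (r / q) * r = q by field_simp] at this
  obtain ⟨K, hK, hK0, hKT⟩ := exists_isCompact_measure_pos hσ hσ0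
  have hKm : MeasurableSet K := hK.measurableSet
  have h1K : Measurable (K.indicator (fun _ => (1 : ℝ≥0∞))) := measurable_const.indicator hKm
  set g := potentialDensity G σ (K.indicator fun _ => 1) with hg
  have hgm : Measurable g := hpot h1K
  have hg0 : ∀ x, 0 < g x := fun x => by
    rw [hg, potentialDensity_indicator hKm, potentialDensity_one]
    refine potential_pos hpos hlsc ?_ x
    rw [Ne, Measure.restrict_eq_zero]
    exact hK0.ne'
  have hgr : ∫⁻ x, g x ^ r ∂σ < ∞ := by
    have h1 : ∫⁻ x, (K.indicator (fun _ => (1 : ℝ≥0∞)) x) ^ (r / q) ∂σ = σ K := by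
      rw [← lintegral_indicator_one hKm]
      refine lintegral_congr fun x => ?_
      by_cases hx : x ∈ K <;> simp [hx, hrq]
    refine (H' _ h1K (h1 ▸ hKT)).trans_lt ?_
    rw [h1]
    exact ENNReal.mul_lt_top (ENNReal.rpow_lt_top_of_nonneg hr.le ENNReal.coe_ne_top)
      (ENNReal.rpow_lt_top_of_nonneg hq.le hKT.ne)
  set Φ : (Ω → ℝ≥0∞) → Ω → ℝ≥0∞ := fun u x => g x + potentialDensity G σ (fun y => u y ^ q) x
    with hΦ
  have hΦmono : Monotone Φ := fun u v huv x => add_le_add_right (potentialDensity_mono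
    (Eventually.of_forall fun y => ENNReal.rpow_le_rpow (huv y) hq.le) x) _
  set U : ℕ → Ω → ℝ≥0∞ := fun n => Φ^[n] 0 with hU
  have hUsucc : ∀ n, U (n + 1) = Φ (U n) := fun n => Function.iterate_succ_apply' Φ n 0
  have hUmono : Monotone U := hΦmono.monotone_iterate_of_le_map fun x => zero_le
  have hUm : ∀ n, Measurable (U n) := by
    intro n
    induction n with
    | zero => exact measurable_zero
    | succ n ih => rw [hUsucc]; exact hgm.add (hpot (ih.pow_const q))
  -- `M` is chosen so that `2 ^ r * (∫ g ^ r + C ^ r * M ^ q) ≤ M`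
  set D : ℝ≥0∞ := max 1 (2 ^ r * ((∫⁻ x, g x ^ r ∂σ) + C ^ r)) with hD
  have hDT : D < ∞ := max_lt ENNReal.one_lt_top (ENNReal.mul_lt_top
    (ENNReal.rpow_lt_top_of_nonneg hr.le (by simp))
    (ENNReal.add_lt_top.2 ⟨hgr, ENNReal.rpow_lt_top_of_nonneg hr.le ENNReal.coe_ne_top⟩))
  have hq' : 0 < 1 - q := by linarith
  set M : ℝ≥0∞ := D ^ (1 / (1 - q)) with hM
  have hMT : M < ∞ := ENNReal.rpow_lt_top_of_nonneg (by positivity) hDT.ne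
  have hM1 : 1 ≤ M := ENNReal.one_le_rpow (le_max_left _ _) (by positivity)
  have hDM : D * M ^ q = M := by
    have : D = M ^ (1 - q) := by
      rw [hM, ← ENNReal.rpow_mul, one_div_mul_cancel hq'.ne', ENNReal.rpow_one]
    rw [this, ← ENNReal.rpow_add_of_nonneg _ _ hq'.le hq.le, sub_add_cancel, ENNReal.rpow_one]
  have hUr : ∀ n, ∫⁻ x, U n x ^ r ∂σ ≤ M := by
    intro n
    induction n with
    | zero => simp [hU, ENNReal.zero_rpow_of_pos hr]
    | succ n ih =>
      have e1 : ∫⁻ x, (U n x ^ q) ^ (r / q) ∂σ = ∫⁻ x, U n x ^ r ∂σ := by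
        refine lintegral_congr fun x => ?_
        rw [← ENNReal.rpow_mul, mul_div_cancel₀ _ hq.ne']
      have e2 := H' (fun y => U n y ^ q) ((hUm n).pow_const q) (e1 ▸ ih.trans_lt hMT)
      rw [e1] at e2
      calc ∫⁻ x, U (n + 1) x ^ r ∂σ
          ≤ ∫⁻ x, 2 ^ r * (g x ^ r + potentialDensity G σ (fun y => U n y ^ q) x ^ r) ∂σ := by
            rw [hUsucc]
            exact lintegral_mono fun x => add_rpow_le_two_rpow_mul hr _ _
        _ = 2 ^ r * (∫⁻ x, g x ^ r ∂σ +
              ∫⁻ x, potentialDensity G σ (fun y => U n y ^ q) x ^ r ∂σ) := by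
            rw [lintegral_const_mul' _ _ (ENNReal.rpow_ne_top_of_nonneg hr.le (by simp)),
              lintegral_add_left (hgm.pow_const r)]
        _ ≤ 2 ^ r * ((∫⁻ x, g x ^ r ∂σ) * M ^ q + C ^ r * M ^ q) := by
            refine mul_le_mul_right (add_le_add ?_ ?_) _
            · exact le_mul_of_one_le_right zero_le (ENNReal.one_le_rpow hM1 hq)
            · exact e2.trans (mul_le_mul_right (ENNReal.rpow_le_rpow ih hq.le) _)
        _ = 2 ^ r * ((∫⁻ x, g x ^ r ∂σ) + C ^ r) * M ^ q := by ring
        _ ≤ D * M ^ q := mul_le_mul_left (le_max_right _ _) _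
        _ = M := hDM
  refine ⟨fun x => ⨆ n, U n x, .iSup hUm, fun x => ?_, ?_, fun x => ?_⟩
  · refine (hg0 x).trans_le (le_iSup_of_le 1 ?_)
    rw [hUsucc 0]
    exact le_self_add
  · simp_rw [iSup_rpow hr]
    rw [lintegral_iSup (fun n => (hUm n).pow_const r)
      fun m n hmn x => ENNReal.rpow_le_rpow (hUmono hmn x) hr.le]
    exact (iSup_le hUr).trans_lt hMT
  · simp_rw [iSup_rpow hq]
    rw [potentialDensity_iSup hlsc (fun n => (hUm n).pow_const q)
      fun m n hmn x => ENNReal.rpow_le_rpow (hUmono hmn x) hq.le]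
    refine iSup_le fun n => le_iSup_of_le (n + 1) ?_
    rw [hUsucc]
    exact le_add_self

/-! ### The lower bound for supersolutions -/

/-- `G(u ^ q σ)` is a better supersolution than `u`: the inequality then holds at every point, and
the function is positive everywhere and lower semicontinuous. -/
theorem exists_lowerSemicontinuous_supersolution [T2Space Ω] [BorelSpace Ω]
    (hpos : ∀ x y, 0 < G x y)
    (hlsc : LowerSemicontinuous (fun z : Ω × Ω => G z.1 z.2))
    {σ : Measure Ω} (hσ : IsRadon σ) (hσ0 : σ ≠ 0) {q r : ℝ} (hq : 0 < q) (hr : 0 < r)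
    {u : Ω → ℝ} (hu : MemLp u (ENNReal.ofReal r) σ) (hsup : IsPositiveSupersolution G σ q u) :
    ∃ v : Ω → ℝ≥0∞, LowerSemicontinuous v ∧ (∀ x, 0 < v x) ∧ ∫⁻ x, v x ^ r ∂σ < ∞ ∧
      ∀ x, potentialDensity G σ (fun y => v y ^ q) x ≤ v x := by
  obtain ⟨hu0, hule⟩ := hsup
  have hU : AEMeasurable (fun x => ENNReal.ofReal (u x)) σ := hu.1.aemeasurable.ennreal_ofReal
  set U := hU.mk _ with hUdef
  have hUu : (fun x => ENNReal.ofReal (u x)) =ᵐ[σ] U := hU.ae_eq_mk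
  have hUm : Measurable fun y => U y ^ q := hU.measurable_mk.pow_const q
  have hcongr : potentialDensity G σ (fun y => ENNReal.ofReal (u y) ^ q) =
      potentialDensity G σ (fun y => U y ^ q) :=
    potentialDensity_congr (hUu.mono fun x hx => congrArg (· ^ q) hx)
  set v := potentialDensity G σ (fun y => U y ^ q) with hv
  have hvU : v ≤ᵐ[σ] U := by
    filter_upwards [hUu, hule] with x h1 h2
    rw [hcongr] at h2
    exact h2.trans h1.le
  refine ⟨v, lowerSemicontinuous_potentialDensity hpos hlsc hσ.innerRegular hUm, fun x => ?_, ?_,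
    fun x => potentialDensity_mono (hvU.mono fun y hy => ENNReal.rpow_le_rpow hy hq.le) x⟩
  · rw [hv, potentialDensity_eq_potential_withDensity hlsc hUm]
    refine potential_pos hpos hlsc (fun h0 => ?_) x
    rw [withDensity_eq_zero_iff hUm.aemeasurable] at h0
    have : NeBot (ae σ) := ae_neBot.2 hσ0
    obtain ⟨y, h1, h2, h3⟩ := (h0.and (hUu.and hu0)).exists
    have h4 : U y ^ q = 0 := h1
    rw [ENNReal.rpow_eq_zero_iff_of_pos hq, ← h2, ENNReal.ofReal_eq_zero] at h4
    exact h4.not_gt h3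
  · have h1 := hu.2
    rw [eLpNorm_ofReal_eq hr, ENNReal.rpow_lt_top_iff_of_pos (by positivity)] at h1
    refine lt_of_le_of_lt (lintegral_mono_ae ?_) h1
    filter_upwards [hvU, hUu, hu0] with x h2 h3 h4
    refine ENNReal.rpow_le_rpow (h2.trans (h3.symm.le.trans ?_)) hr.le
    rw [← ofReal_norm, Real.norm_of_nonneg h4.le]

/-- The lower bound on a compact set where the restricted potential is bounded. There some multiple
of `w ^ (1 / (1 - q))` lies below `v`; let `B` be the best constant. Inserting the bound with
constant `B` into `v ≥ G(v ^ q σ)` reproduces it with constant `κ B ^ q`, so `κ B ^ q ≤ B`. -/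
theorem rpow_potential_restrict_le_of_bounded [T2Space Ω] [BorelSpace Ω]
    (hlsc : LowerSemicontinuous (fun z : Ω × Ω => G z.1 z.2))
    {σ : Measure Ω} {q : ℝ} (hq : 0 < q) (hq1 : q < 1)
    {v : Ω → ℝ≥0∞} (hvl : LowerSemicontinuous v) (hv0 : ∀ x, 0 < v x)
    (hv : ∀ x, potentialDensity G σ (fun y => v y ^ q) x ≤ v x)
    {κ : ℝ≥0∞} (hκ0 : κ ≠ 0) (hκT : κ ≠ ∞) {K : Set Ω} (hK : IsCompact K)
    (hκ : ∀ x, κ * potential G (σ.restrict K) x ^ (1 / (1 - q)) ≤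
      potentialDensity G (σ.restrict K)
        (fun y => potential G (σ.restrict K) y ^ (1 / (1 - q) - 1)) x)
    (hwm : Measurable (potential G (σ.restrict K)))
    {M : ℝ≥0∞} (hM : M ≠ ∞) (hKM : ∀ x ∈ K, potential G (σ.restrict K) x ≤ M) (x : Ω) :
    κ ^ (1 / (1 - q)) * potential G (σ.restrict K) x ^ (1 / (1 - q)) ≤ v x := by
  set S := 1 / (1 - q) with hS
  have hq' : 0 < 1 - q := by linarith
  have hS0 : 0 < S := by positivity
  have hSq : S * q = S - 1 := by rw [hS]; field_simp; ring
  set w := potential G (σ.restrict K) with hw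
  rcases K.eq_empty_or_nonempty with rfl | hKne
  · simp [hw, potential, ENNReal.zero_rpow_of_pos hS0]
  have hstep : ∀ b : ℝ≥0∞, (∀ y ∈ K, b * w y ^ S ≤ v y) → ∀ y, b ^ q * κ * w y ^ S ≤ v y := by
    intro b hb y
    calc b ^ q * κ * w y ^ S = b ^ q * (κ * w y ^ S) := mul_assoc _ _ _
      _ ≤ b ^ q * potentialDensity G (σ.restrict K) (fun y => w y ^ (S - 1)) y :=
          mul_le_mul_right (hκ y) _
      _ = potentialDensity G (σ.restrict K) (fun y => b ^ q * w y ^ (S - 1)) y :=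
          (potentialDensity_const_mul hlsc (hwm.pow_const _) _ y).symm
      _ ≤ potentialDensity G (σ.restrict K) (fun y => v y ^ q) y := by
          refine potentialDensity_mono ?_ y
          filter_upwards [ae_restrict_mem hK.measurableSet] with z hz
          rw [← hSq, ENNReal.rpow_mul, ← ENNReal.mul_rpow_of_nonneg _ _ hq.le]
          exact ENNReal.rpow_le_rpow (hb z hz) hq.le
      _ ≤ potentialDensity G σ (fun y => v y ^ q) y :=
          lintegral_mono' Measure.restrict_le_self le_rfl
      _ ≤ v y := hv y
  have hdiv : ∀ b : ℝ≥0∞, ∀ y ∈ K, b ≤ v y / w y ^ S ↔ b * w y ^ S ≤ v y := fun b y hy =>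
    ENNReal.le_div_iff_mul_le (Or.inr (hv0 y).ne')
      (Or.inl (ENNReal.rpow_ne_top_of_nonneg hS0.le ((hKM y hy).trans_lt hM.lt_top).ne))
  set B := ⨅ y ∈ K, v y / w y ^ S with hB
  have hBv : ∀ y ∈ K, B * w y ^ S ≤ v y := fun y hy => (hdiv B y hy).1 (iInf₂_le y hy)
  have hB0 : B ≠ 0 := by
    obtain ⟨z, hz, hmin⟩ := hvl.lowerSemicontinuousOn K |>.exists_isMinOn hKne hK
    have : v z / M ^ S ≤ B := le_iInf₂ fun y hy =>
      ENNReal.div_le_div (hmin hy) (ENNReal.rpow_le_rpow (hKM y hy) hS0.le)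
    refine (lt_of_lt_of_le (ENNReal.div_pos (hv0 z).ne' ?_) this).ne'
    exact ENNReal.rpow_ne_top_of_nonneg hS0.le hM
  have hκB : κ ^ S ≤ B := by
    rcases eq_or_ne B ∞ with hBT | hBT
    · rw [hBT]; exact le_top
    have h1 : B ^ q * κ ≤ B := le_iInf₂ fun y hy => (hdiv _ y hy).2 (hstep B hBv y)
    have h2 : B ^ q * κ ≤ B ^ q * B ^ (1 - q) := by
      rwa [← ENNReal.rpow_add _ _ hB0 hBT, add_sub_cancel, ENNReal.rpow_one]
    have h3 : κ ≤ B ^ (1 - q) := by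
      rwa [ENNReal.mul_le_mul_iff_right] at h2
      · simp [ENNReal.rpow_eq_zero_iff, hB0, hBT]
      · simp [ENNReal.rpow_eq_top_iff, hB0, hBT]
    calc κ ^ S ≤ (B ^ (1 - q)) ^ S := ENNReal.rpow_le_rpow h3 hS0.le
      _ = B := by rw [← ENNReal.rpow_mul, hS, mul_one_div_cancel hq'.ne', ENNReal.rpow_one]
  have := hstep (κ ^ S) (fun y hy => (mul_le_mul_left hκB _).trans (hBv y hy)) x
  rwa [← ENNReal.rpow_mul, hSq, ← ENNReal.rpow_one κ, ← ENNReal.rpow_mul, one_mul,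
    ← ENNReal.rpow_add _ _ hκ0 hκT, sub_add_cancel] at this

lemma exists_isCompact_lt_potential_restrict [T2Space Ω] [BorelSpace Ω]
    (hlsc : LowerSemicontinuous (fun z : Ω × Ω => G z.1 z.2)) {σ : Measure Ω}
    (hσ : σ.InnerRegular) {x : Ω} {t : ℝ≥0∞} (ht : t < potential G σ x) :
    ∃ K, IsCompact K ∧ t < potential G (σ.restrict K) x := by
  have hreg := innerRegular_withDensity hσ (measurable_kernel hlsc x)
  obtain ⟨K, -, hK, h⟩ := hreg.innerRegular MeasurableSet.univ t
    (by rwa [withDensity_apply _ MeasurableSet.univ, Measure.restrict_univ])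
  exact ⟨K, hK, by rwa [withDensity_apply _ hK.measurableSet] at h⟩

/-- Every supersolution `v` satisfies `v ≥ κ ^ (1 / (1 - q)) * (Gσ) ^ (1 / (1 - q))`, by exhaustion
with compact sets on which the restricted potential is bounded. -/
theorem rpow_potential_le_supersolution [T2Space Ω] [BorelSpace Ω] (hpos : ∀ x y, 0 < G x y)
    (hlsc : LowerSemicontinuous (fun z : Ω × Ω => G z.1 z.2))
    {σ : Measure Ω} (hσ : IsRadon σ) {q : ℝ} (hq : 0 < q) (hq1 : q < 1)
    {v : Ω → ℝ≥0∞} (hvl : LowerSemicontinuous v) (hv0 : ∀ x, 0 < v x)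
    (hvT : ∀ᵐ x ∂σ, v x < ∞) (hv : ∀ x, potentialDensity G σ (fun y => v y ^ q) x ≤ v x)
    {κ : ℝ≥0∞} (hκ0 : κ ≠ 0) (hκT : κ ≠ ∞)
    (hκ : ∀ ν : Measure Ω, IsRadon ν → ∀ x, κ * potential G ν x ^ (1 / (1 - q)) ≤
      potentialDensity G ν (fun y => potential G ν y ^ (1 / (1 - q) - 1)) x) (x : Ω) :
    κ ^ (1 / (1 - q)) * potential G σ x ^ (1 / (1 - q)) ≤ v x := by
  set S := 1 / (1 - q) with hS
  have hq' : 0 < 1 - q := by linarith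
  have hS0 : 0 < S := by positivity
  have hc0 : κ ^ S ≠ 0 := by simp [ENNReal.rpow_eq_zero_iff, hκ0, hκT]
  have hcT : κ ^ S ≠ ∞ := ENNReal.rpow_ne_top_of_nonneg hS0.le hκT
  -- solving for the potential makes the bound stable under suprema
  have hsolve : ∀ t : ℝ≥0∞, κ ^ S * t ^ S ≤ v x ↔ t ≤ (v x / κ ^ S) ^ S⁻¹ := fun t => by
    rw [ENNReal.le_rpow_inv_iff hS0, ENNReal.le_div_iff_mul_le (Or.inl hc0) (Or.inl hcT),
      mul_comm]
  have hwl : ∀ K, MeasurableSet K → LowerSemicontinuous (potential G (σ.restrict K)) := fun K hK =>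
    lowerSemicontinuous_potential hpos hlsc (hσ.restrict hK).innerRegular
  have hbdd : ∀ K, IsCompact K → ∀ M : ℝ≥0∞, M ≠ ∞ →
      (∀ y ∈ K, potential G (σ.restrict K) y ≤ M) →
      potential G (σ.restrict K) x ≤ (v x / κ ^ S) ^ S⁻¹ := fun K hK M hM hKM =>
    (hsolve _).1 (rpow_potential_restrict_le_of_bounded hlsc hq hq1 hvl hv0 hv hκ0 hκT hK
      (hκ _ (hσ.restrict hK.measurableSet)) (hwl K hK.measurableSet).measurable hM hKM x)
  have hcpt : ∀ K, IsCompact K → potential G (σ.restrict K) x ≤ (v x / κ ^ S) ^ S⁻¹ := by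
    intro K hK
    rcases K.eq_empty_or_nonempty with rfl | hKne
    · simp [potential]
    set w := potential G (σ.restrict K) with hw
    -- `v` is bounded below on `K`, which forces `w` to be finite almost everywhere
    obtain ⟨z, hz, hmin⟩ := hvl.lowerSemicontinuousOn K |>.exists_isMinOn hKne hK
    have hvw : ∀ y, v z ^ q * w y ≤ v y := by
      intro y
      calc v z ^ q * w y = potentialDensity G (σ.restrict K) (fun _ => v z ^ q * 1) y := by
            rw [potentialDensity_const_mul hlsc measurable_const, potentialDensity_one]
        _ ≤ potentialDensity G (σ.restrict K) (fun y => v y ^ q) y := by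
            refine potentialDensity_mono ?_ y
            filter_upwards [ae_restrict_mem hK.measurableSet] with t ht
            rw [mul_one]
            exact ENNReal.rpow_le_rpow (hmin ht) hq.le
        _ ≤ potentialDensity G σ (fun y => v y ^ q) y :=
            lintegral_mono' Measure.restrict_le_self le_rfl
        _ ≤ v y := hv y
    have hwT : ∀ᵐ y ∂σ, w y < ∞ := by
      filter_upwards [hvT] with y hy
      refine lt_top_iff_ne_top.2 fun h => ?_
      have h1 := (hvw y).trans_lt hy
      rw [h, ENNReal.mul_top] at h1
      · exact h1.ne rfl
      · rw [Ne, ENNReal.rpow_eq_zero_iff_of_pos hq]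
        exact (hv0 z).ne'
    set L : ℕ → Set Ω := fun n => K ∩ {y | w y ≤ n} with hL
    have hLc : ∀ n, IsCompact (L n) := fun n =>
      hK.inter_right ((hwl K hK.measurableSet).isClosed_preimage n)
    have hLmono : Monotone L := fun m n hmn y hy =>
      ⟨hy.1, (show w y ≤ m from hy.2).trans (Nat.cast_le.2 hmn)⟩
    have hLU : (⋃ n, L n : Set Ω) =ᵐ[σ] K := by
      filter_upwards [hwT] with y hy
      obtain ⟨n, hn⟩ := ENNReal.exists_nat_gt hy.ne
      refine propext ⟨fun h => ?_, fun h => mem_iUnion.2 ⟨n, h, hn.le⟩⟩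
      obtain ⟨m, hm⟩ := mem_iUnion.1 h
      exact hm.1
    calc w x = ∫⁻ y in ⋃ n, L n, G x y ∂σ := (setLIntegral_congr hLU).symm
      _ = ⨆ n, ∫⁻ y in L n, G x y ∂σ :=
          setLIntegral_iUnion_of_directed _ hLmono.directed_le
      _ ≤ _ := iSup_le fun n => hbdd (L n) (hLc n) n (ENNReal.natCast_ne_top n) fun y hy =>
          (lintegral_mono' (Measure.restrict_mono inter_subset_left le_rfl) le_rfl).trans hy.2
  refine (hsolve _).2 (le_of_forall_lt_imp_le_of_dense fun t ht => ?_)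
  obtain ⟨K, hK, h⟩ := exists_isCompact_lt_potential_restrict hlsc hσ.innerRegular ht
  exact h.le.trans (hcpt K hK)

/-- Below a supersolution the iterates of `u ↦ G(u ^ q σ)`, started from the subsolution
`κ ^ (1 / (1 - q)) * (Gσ) ^ (1 / (1 - q))`, increase to a solution. -/
theorem exists_solution_of_supersolution [T2Space Ω] [BorelSpace Ω] (hpos : ∀ x y, 0 < G x y)
    (hlsc : LowerSemicontinuous (fun z : Ω × Ω => G z.1 z.2))
    {σ : Measure Ω} (hσ : IsRadon σ) (hσ0 : σ ≠ 0) {q : ℝ} (hq : 0 < q) (hq1 : q < 1)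
    {v : Ω → ℝ≥0∞} (hv : ∀ x, potentialDensity G σ (fun y => v y ^ q) x ≤ v x)
    {κ : ℝ≥0∞} (hκ0 : κ ≠ 0) (hκT : κ ≠ ∞)
    (hκ : ∀ x, κ * potential G σ x ^ (1 / (1 - q)) ≤
      potentialDensity G σ (fun y => potential G σ y ^ (1 / (1 - q) - 1)) x)
    (hlow : ∀ x, κ ^ (1 / (1 - q)) * potential G σ x ^ (1 / (1 - q)) ≤ v x) :
    ∃ u : Ω → ℝ≥0∞, Measurable u ∧ (∀ x, 0 < u x) ∧ (∀ x, u x ≤ v x) ∧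
      ∀ x, u x = potentialDensity G σ (fun y => u y ^ q) x := by
  set S := 1 / (1 - q) with hS
  have hq' : 0 < 1 - q := by linarith
  have hS0 : 0 < S := by positivity
  have hSq : S * q = S - 1 := by rw [hS]; field_simp; ring
  have hwm : Measurable (potential G σ) :=
    (lowerSemicontinuous_potential hpos hlsc hσ.innerRegular).measurable
  set Φ : (Ω → ℝ≥0∞) → Ω → ℝ≥0∞ := fun u x => potentialDensity G σ (fun y => u y ^ q) x with hΦ
  have hΦmono : Monotone Φ := fun u v huv x => potentialDensity_mono
    (Eventually.of_forall fun y => ENNReal.rpow_le_rpow (huv y) hq.le) x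
  set u₀ : Ω → ℝ≥0∞ := fun x => κ ^ S * potential G σ x ^ S with hu₀
  have hu₀Φ : u₀ ≤ Φ u₀ := by
    intro x
    calc κ ^ S * potential G σ x ^ S = (κ ^ S) ^ q * (κ * potential G σ x ^ S) := by
          rw [← mul_assoc, ← ENNReal.rpow_mul, hSq]
          conv_rhs => rw [← ENNReal.rpow_one κ, ← ENNReal.rpow_mul, one_mul,
            ← ENNReal.rpow_add _ _ hκ0 hκT, sub_add_cancel]
      _ ≤ (κ ^ S) ^ q * potentialDensity G σ (fun y => potential G σ y ^ (S - 1)) x :=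
          mul_le_mul_right (hκ x) _
      _ = Φ u₀ x := by
          rw [← potentialDensity_const_mul hlsc (hwm.pow_const _)]
          simp only [hΦ, hu₀, ENNReal.mul_rpow_of_nonneg _ _ hq.le, ← ENNReal.rpow_mul, hSq]
  set U : ℕ → Ω → ℝ≥0∞ := fun n => Φ^[n] u₀ with hU
  have hUsucc : ∀ n, U (n + 1) = Φ (U n) := fun n => Function.iterate_succ_apply' Φ n u₀
  have hUmono : Monotone U := hΦmono.monotone_iterate_of_le_map hu₀Φ
  have hUm : ∀ n, Measurable (U n) := by
    intro n
    induction n with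
    | zero => exact (hwm.pow_const S).const_mul _
    | succ n ih =>
      rw [hUsucc]
      exact (lowerSemicontinuous_potentialDensity hpos hlsc hσ.innerRegular
        (ih.pow_const q)).measurable
  have hUv : ∀ n, U n ≤ v := by
    intro n
    induction n with
    | zero => exact hlow
    | succ n ih =>
      rw [hUsucc]
      exact (hΦmono ih).trans hv
  refine ⟨fun x => ⨆ n, U n x, .iSup hUm, fun x => ?_, fun x => iSup_le fun n => hUv n x,
    fun x => ?_⟩
  · refine lt_of_lt_of_le ?_ (le_iSup _ 0)
    refine ENNReal.mul_pos ?_ ?_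
    · simp [ENNReal.rpow_eq_zero_iff, hκ0, hκT]
    · rw [Ne, ENNReal.rpow_eq_zero_iff_of_pos hS0]
      exact (potential_pos hpos hlsc hσ0 x).ne'
  · simp_rw [iSup_rpow hq]
    rw [potentialDensity_iSup hlsc (fun n => (hUm n).pow_const q)
      fun m n hmn x => ENNReal.rpow_le_rpow (hUmono hmn x) hq.le]
    refine le_antisymm (iSup_le fun n => ?_) (iSup_le fun n => ?_)
    · refine le_iSup_of_le n ((hUmono (Nat.le_succ n) x).trans (le_of_eq ?_))
      exact congrFun (hUsucc n) x
    · refine le_iSup_of_le (n + 1) (le_of_eq ?_)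
      exact (congrFun (hUsucc n) x).symm

/-! ### The cycle of implications -/

lemma IsPositiveSolution.isPositiveSupersolution {Ω : Type*} [MeasurableSpace Ω]
    {G : Ω → Ω → ℝ≥0∞} {σ : Measure Ω} {q : ℝ} {u : Ω → ℝ} (hu : IsPositiveSolution G σ q u) :
    IsPositiveSupersolution G σ q u :=
  ⟨hu.1, hu.2.mono fun _ hx => hx.ge⟩

lemma toReal_pos_ae {Ω : Type*} [MeasurableSpace Ω] {σ : Measure Ω} {r : ℝ} (hr : 0 < r)
    {u : Ω → ℝ≥0∞} (hu : Measurable u) (hu0 : ∀ x, 0 < u x) (h : ∫⁻ x, u x ^ r ∂σ < ∞) :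
    ∀ᵐ x ∂σ, 0 < (u x).toReal :=
  (ae_lt_top_of_lintegral_rpow_lt_top hr hu h).mono fun x hx =>
    ENNReal.toReal_pos (hu0 x).ne' hx.ne

lemma ofReal_toReal_ae_eq {Ω : Type*} [MeasurableSpace Ω] {σ : Measure Ω} {r : ℝ} (hr : 0 < r)
    {u : Ω → ℝ≥0∞} (hu : Measurable u) (h : ∫⁻ x, u x ^ r ∂σ < ∞) :
    (fun x => ENNReal.ofReal (u x).toReal) =ᵐ[σ] u :=
  (ae_lt_top_of_lintegral_rpow_lt_top hr hu h).mono fun _ hx => ENNReal.ofReal_toReal hx.ne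

theorem exists_supersolution_of_weightedNormInequality [T2Space Ω] [BorelSpace Ω]
    (hpos : ∀ x y, 0 < G x y)
    (hlsc : LowerSemicontinuous (fun z : Ω × Ω => G z.1 z.2))
    {σ : Measure Ω} (hσ : IsRadon σ) (hσ0 : σ ≠ 0) {q r : ℝ} (hq : 0 < q) (hq1 : q < 1)
    (hr : 0 < r) (H : WeightedNormInequality G σ (r / q) r) :
    ∃ u : Ω → ℝ, MemLp u (ENNReal.ofReal r) σ ∧ IsPositiveSupersolution G σ q u := by
  obtain ⟨C, hC⟩ := exists_bound_of_weightedNormInequality hlsc (div_pos hr hq) hr H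
  obtain ⟨u, hum, hu0, hur, hu⟩ := exists_supersolution_of_bound hpos hlsc hσ hσ0 hq hq1 hr hC
  have hae := ofReal_toReal_ae_eq hr hum hur
  refine ⟨fun x => (u x).toReal, memLp_toReal hr hum hur, toReal_pos_ae hr hum hu0 hur, ?_⟩
  rw [potentialDensity_congr (hae.mono fun x hx => congrArg (· ^ q) hx)]
  exact hae.mono fun x hx => (hu x).trans hx.ge

/-- Both conclusions rest on the lower bound `c (Gσ) ^ (1 / (1 - q)) ≤ v`: it gives integrability
of the power of `Gσ` and, at the same time, a subsolution below `v` from which to iterate. -/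
theorem lintegral_lt_top_and_exists_solution_of_supersolution [T2Space Ω] [BorelSpace Ω]
    (hpos : ∀ x y, 0 < G x y)
    (hlsc : LowerSemicontinuous (fun z : Ω × Ω => G z.1 z.2)) (hwmp : WeakMaximumPrinciple G)
    {σ : Measure Ω} (hσ : IsRadon σ) (hσ0 : σ ≠ 0) {q r : ℝ} (hq : 0 < q) (hq1 : q < 1)
    (hr : 0 < r) {u : Ω → ℝ} (hu : MemLp u (ENNReal.ofReal r) σ)
    (hsup : IsPositiveSupersolution G σ q u) :
    ∫⁻ x, potential G σ x ^ (r / (1 - q)) ∂σ < ∞ ∧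
      ∃ u : Ω → ℝ, MemLp u (ENNReal.ofReal r) σ ∧ IsPositiveSolution G σ q u := by
  obtain ⟨h, hh, hwmp⟩ := hwmp
  obtain ⟨v, hvl, hv0, hvr, hv⟩ :=
    exists_lowerSemicontinuous_supersolution hpos hlsc hσ hσ0 hq hr hu hsup
  have hq' : 0 < 1 - q := by linarith
  have hS1 : 1 ≤ 1 / (1 - q) := by rw [le_div_iff₀ hq']; linarith
  have hS0 : 0 < 1 / (1 - q) := by linarith
  set B : ℝ≥0∞ := 2 * (2 * h) ^ (1 / (1 - q) - 1) with hB
  have hh0 : (h : ℝ≥0∞) ≠ 0 := by exact_mod_cast (zero_lt_one.trans_le hh).ne'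
  have hB0 : B ≠ 0 := by simp [hB, ENNReal.rpow_eq_zero_iff, hh0, ENNReal.mul_eq_top]
  have hBT : B ≠ ∞ := ENNReal.mul_ne_top (by simp) (ENNReal.rpow_ne_top_of_nonneg (by linarith)
    (ENNReal.mul_ne_top (by simp) ENNReal.coe_ne_top))
  have hκ0 : B⁻¹ ≠ 0 := ENNReal.inv_ne_zero.2 hBT
  have hκT : B⁻¹ ≠ ∞ := ENNReal.inv_ne_top.2 hB0
  have hκ : ∀ ν : Measure Ω, IsRadon ν → ∀ x, B⁻¹ * potential G ν x ^ (1 / (1 - q)) ≤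
      potentialDensity G ν (fun y => potential G ν y ^ (1 / (1 - q) - 1)) x := by
    intro ν hν x
    rw [ENNReal.mul_le_iff_le_inv hκ0 hκT, inv_inv]
    exact rpow_potential_le hpos hlsc hh hwmp hν hS1 x
  have hlow := rpow_potential_le_supersolution hpos hlsc hσ hq hq1 hvl hv0
    (ae_lt_top_of_lintegral_rpow_lt_top hr hvl.measurable hvr) hv hκ0 hκT hκ
  have hwm : Measurable (potential G σ) :=
    (lowerSemicontinuous_potential hpos hlsc hσ.innerRegular).measurable
  constructor
  · set c := B⁻¹ ^ (1 / (1 - q)) with hc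
    have hc0 : c ^ r ≠ 0 := by
      simp [hc, ENNReal.rpow_eq_zero_iff, hB0, hBT]
    have hle : c ^ r * ∫⁻ x, potential G σ x ^ (r / (1 - q)) ∂σ ≤ ∫⁻ x, v x ^ r ∂σ := by
      rw [← lintegral_const_mul _ (hwm.pow_const _)]
      refine lintegral_mono fun x => ?_
      rw [show r / (1 - q) = 1 / (1 - q) * r by ring, ENNReal.rpow_mul,
        ← ENNReal.mul_rpow_of_nonneg _ _ hr.le]
      exact ENNReal.rpow_le_rpow (hlow x) hr.le
    refine lt_top_iff_ne_top.2 fun htop => ?_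
    rw [htop, ENNReal.mul_top hc0] at hle
    exact (hle.trans_lt hvr).ne rfl
  · obtain ⟨w, hwm, hw0, hwv, hw⟩ :=
      exists_solution_of_supersolution hpos hlsc hσ hσ0 hq hq1 hv hκ0 hκT (hκ σ hσ) hlow
    have hwr : ∫⁻ x, w x ^ r ∂σ < ∞ :=
      (lintegral_mono fun x => ENNReal.rpow_le_rpow (hwv x) hr.le).trans_lt hvr
    have hae := ofReal_toReal_ae_eq hr hwm hwr
    refine ⟨fun x => (w x).toReal, memLp_toReal hr hwm hwr, toReal_pos_ae hr hwm hw0 hwr, ?_⟩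
    rw [potentialDensity_congr (hae.mono fun x hx => congrArg (· ^ q) hx)]
    exact hae.mono fun x hx => hx.trans (hw x)

theorem weightedNormInequality_of_lintegral_lt_top [T2Space Ω] [BorelSpace Ω]
    (hpos : ∀ x y, 0 < G x y)
    (hlsc : LowerSemicontinuous (fun z : Ω × Ω => G z.1 z.2)) (hsymm : QuasiSymmetric G)
    (hwmp : WeakMaximumPrinciple G) {σ : Measure Ω} (hσ : IsRadon σ) (hσ0 : σ ≠ 0) {p r : ℝ}
    (hp : 1 < p) (hr : 0 < r) (hrp : r < p)
    (hW : ∫⁻ x, potential G σ x ^ (p * r / (p - r)) ∂σ < ∞) :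
    WeightedNormInequality G σ p r := by
  obtain ⟨a, -, hsymm⟩ := hsymm
  obtain ⟨h, hh, hwmp⟩ := hwmp
  have hsymm' := fun x y => (hsymm x y).2
  obtain ⟨C, hC, H⟩ : ∃ C : ℝ≥0∞, C ≠ ∞ ∧ ∀ f : Ω → ℝ≥0∞, Measurable f →
      (∫⁻ x, potentialDensity G σ f x ^ r ∂σ) ^ (1 / r) ≤
        C * (∫⁻ x, f x ^ p ∂σ) ^ (1 / p) := by
    rcases lt_or_ge r 1 with h1 | h1
    · exact exists_bound_of_lt_one hpos hlsc hsymm' hwmp hσ hσ0 hp hr h1 hW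
    · exact exists_bound_of_one_le hpos hlsc hh hsymm' hwmp hσ hσ0 h1 hrp hW
  exact weightedNormInequality_of_bound hpos hlsc hσ.innerRegular (by linarith) hr hC H

end KernelPotential

theorem theorem1p1 {Ω : Type*} [TopologicalSpace Ω] [T2Space Ω] [LocallyCompactSpace Ω]
    [MeasurableSpace Ω] [BorelSpace Ω]
    (σ : Measure Ω) (hσ : KernelPotential.IsRadon σ)
    (G : Ω → Ω → ℝ≥0∞) (hpos : ∀ x y, 0 < G x y)
    (hlsc : LowerSemicontinuous (fun z : Ω × Ω => G z.1 z.2))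
    (hsymm : KernelPotential.QuasiSymmetric G)
    (hwmp : KernelPotential.WeakMaximumPrinciple G) :
    (∀ p r : ℝ, 1 < p → 0 < r → r < p →
      (KernelPotential.WeightedNormInequality G σ p r ↔
        ∫⁻ x, KernelPotential.potential G σ x ^ (p * r / (p - r)) ∂σ < ∞)) ∧
    (∀ q r : ℝ, 0 < q → q < 1 → q < r →
      ((∃ u : Ω → ℝ, MemLp u (ENNReal.ofReal r) σ ∧
          KernelPotential.IsPositiveSolution G σ q u) ↔
        KernelPotential.WeightedNormInequality G σ (r / q) r) ∧
      ((∃ u : Ω → ℝ, MemLp u (ENNReal.ofReal r) σ ∧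
          KernelPotential.IsPositiveSupersolution G σ q u) ↔
        KernelPotential.WeightedNormInequality G σ (r / q) r) ∧
      (KernelPotential.WeightedNormInequality G σ (r / q) r ↔
        ∫⁻ x, KernelPotential.potential G σ x ^ (r / (1 - q)) ∂σ < ∞)) := by
  open KernelPotential in
  rcases eq_or_ne σ 0 with rfl | hσ0
  · have hW : ∀ p r : ℝ, WeightedNormInequality G (0 : Measure Ω) p r := fun p r =>
      ⟨1, one_pos, fun f _ => ⟨by simp, by simp⟩⟩
    refine ⟨fun p r _ _ _ => ⟨fun _ => by simp, fun _ => hW _ _⟩, fun q r _ _ _ => ?_⟩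
    have h0 : MemLp (0 : Ω → ℝ) (ENNReal.ofReal r) (0 : Measure Ω) := MemLp.zero
    exact ⟨⟨fun _ => hW _ _, fun _ => ⟨0, h0, by simp, by simp⟩⟩,
      ⟨fun _ => hW _ _, fun _ => ⟨0, h0, by simp, by simp⟩⟩, fun _ => by simp, fun _ => hW _ _⟩
  have key : ∀ q r : ℝ, 0 < q → q < 1 → 0 < r → WeightedNormInequality G σ (r / q) r →
      ∫⁻ x, potential G σ x ^ (r / (1 - q)) ∂σ < ∞ ∧
        ∃ u : Ω → ℝ, MemLp u (ENNReal.ofReal r) σ ∧ IsPositiveSolution G σ q u := by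
    intro q r hq hq1 hr H
    obtain ⟨u, hu, hsup⟩ :=
      exists_supersolution_of_weightedNormInequality hpos hlsc hσ hσ0 hq hq1 hr H
    exact lintegral_lt_top_and_exists_solution_of_supersolution hpos hlsc hwmp hσ hσ0 hq hq1 hr
      hu hsup
  constructor
  · intro p r hp hr hrp
    refine ⟨fun H => ?_, fun hW =>
      weightedNormInequality_of_lintegral_lt_top hpos hlsc hsymm hwmp hσ hσ0 hp hr hrp hW⟩
    -- every admissible pair `(p, r)` has the form `(r / q, r)` with `q = r / p`
    have hp0 : 0 < p := by linarith
    have hpr : 0 < p - r := by linarith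
    have e1 : r / (r / p) = p := by field_simp
    have e2 : r / (1 - r / p) = p * r / (p - r) := by
      rw [one_sub_div hp0.ne', div_div_eq_mul_div, mul_comm]
    have := (key (r / p) r (by positivity) ((div_lt_one hp0).2 hrp) hr (by rwa [e1])).1
    rwa [e2] at this
  · intro q r hq hq1 hqr
    have hr : 0 < r := hq.trans hqr
    have hq' : 0 < 1 - q := by linarith
    have hrq : 1 < r / q := (one_lt_div hq).2 hqr
    have hrrq : r < r / q := by rw [lt_div_iff₀ hq]; nlinarith
    have e : r / q * r / (r / q - r) = r / (1 - q) := by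
      have : r / q - r = r * (1 - q) / q := by field_simp
      rw [this]
      field_simp
    have hback : ∫⁻ x, potential G σ x ^ (r / (1 - q)) ∂σ < ∞ →
        WeightedNormInequality G σ (r / q) r := fun hW =>
      weightedNormInequality_of_lintegral_lt_top hpos hlsc hsymm hwmp hσ hσ0 hrq hr hrrq
        (by rwa [e])
    have hsuper : (∃ u : Ω → ℝ, MemLp u (ENNReal.ofReal r) σ ∧
        IsPositiveSupersolution G σ q u) → WeightedNormInequality G σ (r / q) r := by
      rintro ⟨u, hu, hsup⟩
      exact hback (lintegral_lt_top_and_exists_solution_of_supersolution hpos hlsc hwmp hσ hσ0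
        hq hq1 hr hu hsup).1
    refine ⟨⟨fun ⟨u, hu, hsol⟩ => hsuper ⟨u, hu, hsol.isPositiveSupersolution⟩,
      fun H => (key q r hq hq1 hr H).2⟩, ⟨hsuper, fun H => ?_⟩,
      fun H => (key q r hq hq1 hr H).1, hback⟩
    obtain ⟨u, hu, hsol⟩ := (key q r hq hq1 hr H).2
    exact ⟨u, hu, hsol.isPositiveSupersolution⟩
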